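/- Let $N=N_n\to\infty$ and $M=M_n$ be sequences of positive integers with $M\mid N$ and $M=o(N)$ (for instance $M$ fixed), and let $p=p_n,\ q=q_n\in[0,1]$. Let $V=\{1,\dots,N\}$ be partitioned into $M$ blocks of size $N/M$, and let $G$ be the random graph on $V$ (loops allowed) in which the pairs $\{v,w\}$, $v,w\in V$ (including $v=w$), are edges independently of each other, with probability $p$ if $v$ and $w$ lie in the same block and with probability $q$ otherwise (the stochastic block model with identical intra-block probabilities). Assume that, as $n\to\infty$, $$\frac{M\log^4 N}{Np+N(M-1)q}\longrightarrow 0,\qquad q\gg\sqrt{\frac{p\log N}{NM}},$$ and that the limit $\kappa=\lim_{n\to\infty}\frac{(M-1)q}{p}\in[0,\infty]$ exists (here $a\gg b$ means $b=o(a)$). For a realization of $G$ let $d_v$ be the degree of $v$ (a loop counts once), consider simple random walk on $G$, which moves from $v$ to each vertex $w$ such that $\{v,w\}$ is an edge with probability $1/d_v$, and let $\pi_v=d_v/\sum_{u\in V}d_u$ be its invariant distribution. Let $H_{vw}$ be the expected first time $t\ge 0$ at which the walk started at $v$ is at $w$, and for each target vertex $w$ put $$H_w=\sum_{v\in V}\pi_v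 H_{vw}.$$ Then $H_w=N(1+o(1))$ asymptotically almost surely, that is, for every $\varepsilon>0$, with probability tending to $1$ as $n\to\infty$, the graph $G$ is connected and, for every $w\in V$, $H_w$ is finite and $$\left|\frac{H_w}{N}-1\right|\le\varepsilon .$$ -/

import Mathlib

open MeasureTheory ProbabilityTheory Filter Asymptotics
open scoped ENNReal Topology

namespace SBM

/-- A realization of a random graph, loops allowed, on the vertex set `Fin N`: the family of edge
indicators `ε_{v,w}`, indexed by the unordered pairs `{v, w}`; the pair `{v, v}` is a loop at `v`. -/
abbrev Config (N : ℕ) : Type := Sym2 (Fin N) → Bool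

/-- The probability that the pair `{v, w}` is an edge: `p` if the two vertices lie in the same block
and `q` otherwise. The block of `v` is `B v`. -/
def edgeProb {N M : ℕ} (B : Fin N → Fin M) (p q : unitInterval) : Sym2 (Fin N) → unitInterval :=
  Sym2.lift ⟨fun v w => if B v = B w then p else q, fun v w => by simp only [eq_comm]⟩

/-- The law of the stochastic block model with diagonal entries `p` and off-diagonal entries `q`:
the edge indicators are independent, each with its own Bernoulli law. -/
noncomputable def sbmMeasure {N M : ℕ} (B : Fin N → Fin M) (p q : unitInterval) :
    Measure (Config N) :=
  Measure.pi fun e => bernoulliMeasure true false (edgeProb B p q e)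

/-- The set of neighbours of `v`; it contains `v` itself if and only if there is a loop at `v`. -/
def nbrs {N : ℕ} (ω : Config N) (v : Fin N) : Finset (Fin N) :=
  Finset.univ.filter fun w => ω s(v, w) = true

/-- The degree `d_v` of `v`; a loop counts once. -/
def deg {N : ℕ} (ω : Config N) (v : Fin N) : ℕ := (nbrs ω v).card

/-- The underlying simple graph (loops removed); it only serves to say that the realization is
connected. -/
def graph {N : ℕ} (ω : Config N) : SimpleGraph (Fin N) where
  Adj v w := v ≠ w ∧ ω s(v, w) = true
  symm := ⟨fun v w h => ⟨h.1.symm, by rw [Sym2.eq_swap]; exact h.2⟩⟩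
  loopless := ⟨fun _ h => h.1 rfl⟩

/-- One step of simple random walk: from `v`, move to a uniformly chosen neighbour of `v`.
(At a vertex of degree `0`, which does not exist in a connected realization with at least two
vertices, the walk stays put.) -/
noncomputable def step {N : ℕ} (ω : Config N) (v : Fin N) : Measure (Fin N) :=
  if nbrs ω v = ∅ then Measure.dirac v else uniformOn (nbrs ω v : Set (Fin N))

/-- The transition kernel of simple random walk. -/
noncomputable def stepKernel {N : ℕ} (ω : Config N) : Kernel (Fin N) (Fin N) :=
  Kernel.ofFunOfCountable (step ω)

instance {N : ℕ} (ω : Config N) : IsMarkovKernel (stepKernel ω) := by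
  refine ⟨fun v => ?_⟩
  change IsProbabilityMeasure (step ω v)
  unfold step
  split_ifs with h
  · infer_instance
  · exact isProbabilityMeasure_uniformOn (Finset.finite_toSet _)
      (by simpa using Finset.nonempty_iff_ne_empty.mpr h)

/-- Given the walk up to time `t`, the position at time `t + 1` is drawn from the transition kernel
at the current position. -/
noncomputable def walkKernel {N : ℕ} (ω : Config N) (t : ℕ) :
    Kernel (Π _ : Finset.Iic t, Fin N) (Fin N) :=
  (stepKernel ω).comap (fun x => x ⟨t, Finset.mem_Iic.mpr le_rfl⟩) (measurable_pi_apply _)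

instance {N : ℕ} (ω : Config N) (t : ℕ) : IsMarkovKernel (walkKernel ω t) := by
  unfold walkKernel; infer_instance

/-- The law, on the space of trajectories, of simple random walk started at `v`. -/
noncomputable def walkLaw {N : ℕ} (ω : Config N) (v : Fin N) : Measure (ℕ → Fin N) :=
  Kernel.traj (X := fun _ => Fin N) (walkKernel ω) 0 (fun _ => v)

/-- The first time `t ≥ 0` at which the trajectory `x` is at `w` (`∞` if it never is). -/
noncomputable def hittingTime {N : ℕ} (w : Fin N) (x : ℕ → Fin N) : ℝ≥0∞ :=
  ⨅ (t : ℕ) (_ : x t = w), (t : ℝ≥0∞)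

/-- `H_{vw}`: the expected time that the walk started at `v` takes to reach `w`. -/
noncomputable def expHit {N : ℕ} (ω : Config N) (v w : Fin N) : ℝ≥0∞ :=
  ∫⁻ x, hittingTime w x ∂(walkLaw ω v)

/-- The invariant distribution `π_v = d_v / ∑_u d_u`. -/
noncomputable def statDist {N : ℕ} (ω : Config N) (v : Fin N) : ℝ≥0∞ :=
  (deg ω v : ℝ≥0∞) / ∑ u, (deg ω u : ℝ≥0∞)

/-- `H_w = ∑_v π_v H_{vw}`. -/
noncomputable def avgHit {N : ℕ} (ω : Config N) (w : Fin N) : ℝ≥0∞ :=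
  ∑ v, statDist ω v * expHit ω v w

end SBM

/-!
Let `k v` be the expected time to hit `w` from `v`, `d` the degrees and `vol` their sum. The
first-step equations say that the Laplacian of `k` is `d - vol • 1_w` and `k w = 0`; therefore the
Dirichlet energy of `k` is `vol * H_w`, and the Laplacian at `w` gives `d_w * H_w - (vol - d_w) =
∑ u ∼ w, (H_w - k u)`. The Cauchy-Schwarz inequality and the Poincaré inequality bound the
right-hand side by the energy, so `H_w ≈ vol / d_w` once the degrees are small compared with the
square of the edge expansion. The Poincaré inequality comes from Cheeger's argument. In the block
model, Chernoff bounds with union bounds over the vertices and over the cuts make all degrees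
asymptotically equal, so that `vol / d_w ≈ N`, and give the edge expansion.
-/

namespace SBM

open scoped Finset

section Network

variable {V : Type*} [Fintype V] {a : V → V → ℝ}

/-- The degree of `u` in the network on `V` in which the pair `(u, v)` has conductance `a u v`. -/
def degree (a : V → V → ℝ) (u : V) : ℝ := ∑ v, a u v

/-- The Laplacian of the network `a`; the walk with conductances `a` solves its hitting time
equations in terms of this operator. -/
def laplacian (a : V → V → ℝ) (f : V → ℝ) (u : V) : ℝ := ∑ v, a u v * (f u - f v)

/-- The Dirichlet energy of `f`. The sum is over ordered pairs, so every edge is counted twice. -/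
def energy (a : V → V → ℝ) (f : V → ℝ) : ℝ := ∑ u, ∑ v, a u v * (f u - f v) ^ 2

/-- The total variation of `f`, the `ℓ¹` analogue of the energy. The sum is over ordered pairs, so
every edge is counted twice. -/
def variation (a : V → V → ℝ) (f : V → ℝ) : ℝ := ∑ u, ∑ v, a u v * |f u - f v|

lemma laplacian_eq (a : V → V → ℝ) (f : V → ℝ) (u : V) :
    laplacian a f u = degree a u * f u - ∑ v, a u v * f v := by
  simp only [laplacian, degree, mul_sub, Finset.sum_sub_distrib, Finset.sum_mul]

lemma sum_laplacian (hsym : ∀ u v, a u v = a v u) (f : V → ℝ) : ∑ u, laplacian a f u = 0 := by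
  have hanti : ∑ u, laplacian a f u = -∑ u, laplacian a f u := by
    conv_lhs => unfold laplacian; rw [Finset.sum_comm]
    simp only [laplacian, ← Finset.sum_neg_distrib]
    exact Finset.sum_congr rfl fun u _ => Finset.sum_congr rfl fun v _ => by rw [hsym]; ring
  linarith

lemma energy_nonneg (ha : ∀ u v, 0 ≤ a u v) (f : V → ℝ) : 0 ≤ energy a f :=
  Finset.sum_nonneg fun u _ => Finset.sum_nonneg fun v _ => mul_nonneg (ha u v) (sq_nonneg _)

lemma energy_eq_two_mul_sum_mul_laplacian (hsym : ∀ u v, a u v = a v u) (f : V → ℝ) :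
    energy a f = 2 * ∑ u, f u * laplacian a f u := by
  have hswap : ∑ u, ∑ v, a u v * (f v * (f v - f u)) = ∑ u, f u * laplacian a f u := by
    rw [Finset.sum_comm]
    simp only [laplacian, Finset.mul_sum]
    exact Finset.sum_congr rfl fun u _ => Finset.sum_congr rfl fun v _ => by rw [hsym]; ring
  rw [two_mul]
  nth_rw 1 [← hswap]
  simp only [energy, laplacian, Finset.mul_sum, ← Finset.sum_add_distrib]
  exact Finset.sum_congr rfl fun u _ => Finset.sum_congr rfl fun v _ => by ring

lemma energy_sub_const (a : V → V → ℝ) (f : V → ℝ) (m : ℝ) :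
    energy a (fun v => f v - m) = energy a f := by
  simp only [energy, sub_sub_sub_cancel_right]

lemma sq_eq_sq_posPart_add_sq_negPart (x : ℝ) : x ^ 2 = x⁺ ^ 2 + x⁻ ^ 2 := by
  rcases le_total 0 x with hx | hx
  · simp [posPart_of_nonneg hx, negPart_of_nonneg hx]
  · simp [posPart_of_nonpos hx, negPart_of_nonpos hx]

lemma energy_posPart_add_energy_negPart_le (ha : ∀ u v, 0 ≤ a u v) (f : V → ℝ) :
    energy a (fun v => (f v)⁺) + energy a (fun v => (f v)⁻) ≤ energy a f := by
  simp only [energy, ← Finset.sum_add_distrib, ← mul_add]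
  refine Finset.sum_le_sum fun u _ => Finset.sum_le_sum fun v _ =>
    mul_le_mul_of_nonneg_left ?_ (ha u v)
  have hu := sq_eq_sq_posPart_add_sq_negPart (f u)
  have hv := sq_eq_sq_posPart_add_sq_negPart (f v)
  have hcross : f u * f v ≤ (f u)⁺ * (f v)⁺ + (f u)⁻ * (f v)⁻ := by
    nth_rw 1 [← posPart_sub_negPart (f u), ← posPart_sub_negPart (f v)]
    linarith [mul_nonneg (posPart_nonneg (f u)) (negPart_nonneg (f v)),
      mul_nonneg (negPart_nonneg (f u)) (posPart_nonneg (f v))]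
  linarith

lemma sum_sum_mul_sq_le {D : ℝ} (hD : ∀ u, degree a u ≤ D) (f : V → ℝ) :
    ∑ u, ∑ v, a u v * f u ^ 2 ≤ D * ∑ u, f u ^ 2 := by
  simp only [← Finset.sum_mul, Finset.mul_sum]
  exact Finset.sum_le_sum fun u _ => mul_le_mul_of_nonneg_right (hD u) (sq_nonneg _)

lemma sum_sum_mul_add_sq_le {D : ℝ} (ha : ∀ u v, 0 ≤ a u v) (hsym : ∀ u v, a u v = a v u)
    (hD : ∀ u, degree a u ≤ D) (f : V → ℝ) :
    ∑ u, ∑ v, a u v * (f u + f v) ^ 2 ≤ 4 * D * ∑ u, f u ^ 2 := by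
  have hswap : ∑ u, ∑ v, a u v * f v ^ 2 = ∑ u, ∑ v, a u v * f u ^ 2 := by
    rw [Finset.sum_comm]
    simp only [hsym]
  calc ∑ u, ∑ v, a u v * (f u + f v) ^ 2
      ≤ ∑ u, ∑ v, (2 * (a u v * f u ^ 2) + 2 * (a u v * f v ^ 2)) :=
        Finset.sum_le_sum fun u _ => Finset.sum_le_sum fun v _ => by
          linarith [mul_le_mul_of_nonneg_left (add_sq_le (a := f u) (b := f v)) (ha u v)]
    _ = 4 * ∑ u, ∑ v, a u v * f u ^ 2 := by
        simp only [Finset.sum_add_distrib, ← Finset.mul_sum, hswap]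
        ring
    _ ≤ 4 * D * ∑ u, f u ^ 2 := by linarith [sum_sum_mul_sq_le hD f]

lemma sq_variation_sq_le {D : ℝ} (ha : ∀ u v, 0 ≤ a u v) (hsym : ∀ u v, a u v = a v u)
    (hD : ∀ u, degree a u ≤ D) (f : V → ℝ) :
    variation a (fun v => f v ^ 2) ^ 2 ≤ energy a f * (4 * D * ∑ u, f u ^ 2) := by
  have cauchy_schwarz : (∑ z : V × V, a z.1 z.2 * |f z.1 ^ 2 - f z.2 ^ 2|) ^ 2 ≤
      (∑ z : V × V, a z.1 z.2 * (f z.1 - f z.2) ^ 2) *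
        ∑ z : V × V, a z.1 z.2 * (f z.1 + f z.2) ^ 2 := by
    refine Finset.sum_sq_le_sum_mul_sum_of_sq_le_mul _
      (fun z _ => mul_nonneg (ha _ _) (sq_nonneg _))
      (fun z _ => mul_nonneg (ha _ _) (sq_nonneg _)) fun z _ => le_of_eq ?_
    rw [mul_pow, sq_abs]
    ring
  simp only [Fintype.sum_prod_type] at cauchy_schwarz
  exact cauchy_schwarz.trans
    (mul_le_mul_of_nonneg_left (sum_sum_mul_add_sq_le ha hsym hD f) (energy_nonneg ha f))

end Network

lemma exists_median {V α : Type*} [Fintype V] [Nonempty V] [LinearOrder α] (f : V → α) :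
    ∃ m, 2 * #{v | m < f v} ≤ Fintype.card V ∧ 2 * #{v | f v < m} ≤ Fintype.card V := by
  obtain ⟨x, hx, hmin⟩ := Finset.exists_min_image
    ({x | 2 * #{v | f x < f v} ≤ Fintype.card V} : Finset V) f <| by
      obtain ⟨x, -, hmax⟩ := Finset.univ.exists_max_image f Finset.univ_nonempty
      exact ⟨x, by simp [Finset.filter_false_of_mem fun v hv => not_lt.2 (hmax v hv)]⟩
  refine ⟨f x, by simpa using hx, ?_⟩
  rcases ({v | f v < f x} : Finset V).eq_empty_or_nonempty with hbelow | hbelow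
  · simp [hbelow]
  obtain ⟨y, hy, hmax⟩ := Finset.exists_max_image _ f hbelow
  have hyx : f y < f x := by simpa using hy
  have habove : Fintype.card V < 2 * #{v | f y < f v} := by
    by_contra! hle
    exact (hmin y (by simpa using hle)).not_gt hyx
  have hdisj : Disjoint ({v | f v < f x} : Finset V) ({v | f y < f v} : Finset V) :=
    Finset.disjoint_left.2 fun v hv hv' => (hmax v hv).not_gt (by simpa using hv')
  have hunion := Finset.card_le_univ (({v | f v < f x} : Finset V).disjUnion _ hdisj)
  rw [Finset.card_disjUnion] at hunion
  omega

lemma sum_mul_sq_sub_mean_le {ι : Type*} {s : Finset ι} {w f : ι → ℝ} {H : ℝ}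
    (hw : ∀ i ∈ s, 0 ≤ w i) (hH : (∑ i ∈ s, w i) * H = ∑ i ∈ s, w i * f i) (m : ℝ) :
    ∑ i ∈ s, w i * (f i - H) ^ 2 ≤ ∑ i ∈ s, w i * (f i - m) ^ 2 := by
  have hexpand : ∀ i, w i * (f i - m) ^ 2 =
      w i * (f i - H) ^ 2 + (H - m) ^ 2 * w i + 2 * (H - m) * (w i * f i - w i * H) :=
    fun i => by ring
  simp only [hexpand, Finset.sum_add_distrib, ← Finset.mul_sum, Finset.sum_sub_distrib,
    ← Finset.sum_mul, hH, sub_self, mul_zero, add_zero]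
  exact le_add_of_nonneg_right (mul_nonneg (sq_nonneg _) (Finset.sum_nonneg hw))

section Expansion

variable {V : Type*} [Fintype V] [DecidableEq V] {a b : V → V → ℝ} {c D : ℝ}

/-- The total conductance of the edges that leave `S`. -/
def cut (a : V → V → ℝ) (S : Finset V) : ℝ := ∑ u ∈ S, ∑ v ∈ Sᶜ, a u v

/-- The network `a` expands at rate `c`: the edges that leave a set `S` of at most half of the
vertices have total conductance at least `c * |S|`. -/
def Expands (a : V → V → ℝ) (c : ℝ) : Prop :=
  ∀ S : Finset V, 2 * #S ≤ Fintype.card V → c * #S ≤ cut a S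

lemma cut_compl (hsym : ∀ u v, a u v = a v u) (S : Finset V) : cut a Sᶜ = cut a S := by
  simp only [cut, compl_compl]
  rw [Finset.sum_comm]
  simp only [hsym]

lemma variation_add_indicator (hsym : ∀ u v, a u v = a v u) {f : V → ℝ} (hf : ∀ v, 0 ≤ f v)
    {S : Finset V} (hS : ∀ v ∉ S, f v = 0) {m : ℝ} (hm : 0 ≤ m) :
    variation a (fun v => f v + if v ∈ S then m else 0) = variation a f + 2 * m * cut a S := by
  have hterm : ∀ u v,
      a u v * |(f u + if u ∈ S then m else 0) - (f v + if v ∈ S then m else 0)| =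
        a u v * |f u - f v| + ((if u ∈ S then if v ∈ Sᶜ then m * a u v else 0 else 0) +
          if v ∈ S then if u ∈ Sᶜ then m * a v u else 0 else 0) := by
    intro u v
    by_cases hu : u ∈ S <;> by_cases hv : v ∈ S
    · simp [hu, hv]
    · simp [hu, hv, hS v hv, abs_of_nonneg, hf u, add_nonneg (hf u) hm]
      ring
    · rw [abs_sub_comm, abs_sub_comm (f u)]
      simp [hu, hv, hS u hu, hsym v u, abs_of_nonneg, hf v, add_nonneg (hf v) hm]
      ring
    · simp [hu, hv]
  have hcut : ∑ u, ∑ v, (if u ∈ S then if v ∈ Sᶜ then m * a u v else 0 else 0) = m * cut a S := by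
    simp only [Finset.sum_ite_irrel, Finset.sum_const_zero, Finset.sum_ite_mem, Finset.univ_inter,
      cut, Finset.mul_sum]
  simp only [variation, hterm, Finset.sum_add_distrib]
  rw [Finset.sum_comm (f := fun u v => if v ∈ S then if u ∈ Sᶜ then m * a v u else 0 else 0), hcut]
  ring

/-- The co-area argument: peeling off the layer `{f ≥ min f}` of the support removes a point from
it, and the variation of a layer is twice its cut. -/
lemma Expands.two_mul_sum_le_variation (hsym : ∀ u v, a u v = a v u) (hexp : Expands a c)
    {S : Finset V} (hcard : 2 * #S ≤ Fintype.card V) {f : V → ℝ} (hf : ∀ v, 0 ≤ f v)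
    (hS : ∀ v ∉ S, f v = 0) : 2 * c * ∑ v, f v ≤ variation a f := by
  induction S using Finset.strongInduction generalizing f with
  | H S ih =>
    rcases S.eq_empty_or_nonempty with rfl | hne
    · simp [variation, fun v => hS v (Finset.notMem_empty v)]
    obtain ⟨x, hx, hmin⟩ := S.exists_min_image f hne
    set g : V → ℝ := fun v => f v - if v ∈ S then f x else 0 with hg
    have hfg : f = fun v => g v + if v ∈ S then f x else 0 := by simp [hg]
    have hg0 : ∀ v, 0 ≤ g v := fun v => by
      by_cases hv : v ∈ S
      · simpa [hg, hv] using hmin v hv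
      · simpa [hg, hv] using hf v
    have hgS : ∀ v ∉ S, g v = 0 := fun v hv => by simp [hg, hv, hS v hv]
    have hg_erase : ∀ v ∉ S.erase x, g v = 0 := fun v hv => by
      by_cases hvS : v ∈ S
      · obtain rfl : v = x := by_contra fun h => hv (Finset.mem_erase.2 ⟨h, hvS⟩)
        simp [hg, hx]
      · exact hgS v hvS
    have hpeeled : 2 * c * ∑ v, g v ≤ variation a g :=
      ih _ (Finset.erase_ssubset hx) ((Nat.mul_le_mul_left 2 (Finset.card_erase_le)).trans hcard)
        hg0 hg_erase
    have hsum : ∑ v, f v = ∑ v, g v + f x * #S := by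
      simp [hg, Finset.sum_sub_distrib, mul_comm]
    have hvar : variation a f = variation a g + 2 * f x * cut a S := by
      nth_rw 1 [hfg]
      exact variation_add_indicator hsym hg0 hgS (hf x)
    rw [hsum, hvar]
    linarith [mul_le_mul_of_nonneg_left (hexp S hcard) (hf x)]

lemma Expands.mono (hexp : Expands a c) (hab : ∀ u v, a u v ≤ b u v) : Expands b c :=
  fun S hS => (hexp S hS).trans
    (Finset.sum_le_sum fun u _ => Finset.sum_le_sum fun v _ => hab u v)

lemma Expands.mul_const (hexp : Expands a c) {t : ℝ} (ht : 0 ≤ t) :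
    Expands (fun u v => a u v * t) (c * t) := fun S hS => by
  have hcut : cut (fun u v => a u v * t) S = cut a S * t := by simp only [cut, Finset.sum_mul]
  rw [hcut, mul_right_comm]
  exact mul_le_mul_of_nonneg_right (hexp S hS) ht

lemma expands_one : Expands (fun _ _ : V => (1 : ℝ)) (Fintype.card V / 2) := fun S hS => by
  have hcompl : (#S : ℝ) + #Sᶜ = Fintype.card V := by exact_mod_cast S.card_add_card_compl
  have hhalf : 2 * (#S : ℝ) ≤ Fintype.card V := by exact_mod_cast hS
  simp only [cut, Finset.sum_const, nsmul_eq_mul, mul_one]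
  rw [mul_comm]
  exact mul_le_mul_of_nonneg_left (by linarith) (Nat.cast_nonneg _)

lemma Expands.eq_univ_of_cut_eq_zero (hexp : Expands a c) (hc : 0 < c)
    (hsym : ∀ u v, a u v = a v u) {S : Finset V} (hne : S.Nonempty) (hcut : cut a S = 0) :
    S = Finset.univ := by
  have eq_empty : ∀ T : Finset V, cut a T = 0 → 2 * #T ≤ Fintype.card V → T = ∅ := by
    intro T hT hcard
    have h : c * #T ≤ c * 0 := by simpa [hT] using hexp T hcard
    simpa using le_of_mul_le_mul_left h hc
  have hcompl := S.card_add_card_compl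
  rcases le_total (2 * #S) (Fintype.card V) with h | h
  · exact absurd (eq_empty S hcut h) hne.ne_empty
  · simpa using eq_empty Sᶜ (by rw [cut_compl hsym, hcut]) (by omega)

lemma Expands.eq_of_energy_eq_zero (hexp : Expands a c) (hc : 0 < c) (ha : ∀ u v, 0 ≤ a u v)
    (hsym : ∀ u v, a u v = a v u) {f : V → ℝ} (hf : energy a f = 0) (u v : V) : f v = f u := by
  have hterm : ∀ x y, 0 ≤ a x y * (f x - f y) ^ 2 := fun x y => mul_nonneg (ha x y) (sq_nonneg _)
  have hedge : ∀ x y, a x y * (f x - f y) ^ 2 = 0 := fun x y =>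
    congrFun ((Fintype.sum_eq_zero_iff_of_nonneg (hterm x)).1 (congrFun
      ((Fintype.sum_eq_zero_iff_of_nonneg fun x => Finset.sum_nonneg fun y _ => hterm x y).1 hf)
      x)) y
  have hlevel : ({y | f y = f u} : Finset V) = Finset.univ := by
    refine hexp.eq_univ_of_cut_eq_zero hc hsym ⟨u, by simp⟩ ?_
    refine Finset.sum_eq_zero fun x hx => Finset.sum_eq_zero fun y hy => ?_
    simp only [Finset.mem_compl, Finset.mem_filter_univ] at hx hy
    exact (mul_eq_zero.1 (hedge x y)).resolve_right
      (pow_ne_zero 2 (sub_ne_zero.2 fun h => hy (h ▸ hx)))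
  exact (Finset.mem_filter_univ v).1 (hlevel ▸ Finset.mem_univ v)

section Poincare

variable [Nonempty V]

lemma Expands.sq_mul_sum_sq_le_of_card_support_le (hexp : Expands a c) (hc : 0 ≤ c)
    (ha : ∀ u v, 0 ≤ a u v) (hsym : ∀ u v, a u v = a v u) (hD : ∀ u, degree a u ≤ D) {f : V → ℝ}
    (hcard : 2 * #{v | f v ≠ 0} ≤ Fintype.card V) :
    c ^ 2 * ∑ v, f v ^ 2 ≤ D * energy a f := by
  have hD0 : 0 ≤ D :=
    (Finset.sum_nonneg fun v _ => ha (Classical.arbitrary V) v).trans (hD _)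
  have hE : 0 ≤ energy a f := energy_nonneg ha f
  set X := ∑ v, f v ^ 2
  have hvar : 2 * c * X ≤ variation a fun v => f v ^ 2 :=
    hexp.two_mul_sum_le_variation hsym hcard (fun v => sq_nonneg _) (by simp)
  have hX_nonneg : 0 ≤ X := Finset.sum_nonneg fun v _ => sq_nonneg (f v)
  rcases hX_nonneg.eq_or_lt with hX0 | hX0
  · rw [← hX0, mul_zero]
    positivity
  have hsq : (2 * c * X) ^ 2 ≤ energy a f * (4 * D * X) :=
    (pow_le_pow_left₀ (by positivity) hvar 2).trans (sq_variation_sq_le ha hsym hD f)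
  exact le_of_mul_le_mul_left (by linarith : X * (c ^ 2 * X) ≤ X * (D * energy a f)) hX0

lemma Expands.exists_sq_mul_sum_sq_sub_le (hexp : Expands a c) (hc : 0 ≤ c)
    (ha : ∀ u v, 0 ≤ a u v) (hsym : ∀ u v, a u v = a v u) (hD : ∀ u, degree a u ≤ D) (f : V → ℝ) :
    ∃ m, c ^ 2 * ∑ v, (f v - m) ^ 2 ≤ D * energy a f := by
  have hD0 : 0 ≤ D :=
    (Finset.sum_nonneg fun v _ => ha (Classical.arbitrary V) v).trans (hD _)
  obtain ⟨m, habove, hbelow⟩ := exists_median f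
  have hpos := hexp.sq_mul_sum_sq_le_of_card_support_le hc ha hsym hD
    (f := fun v => (f v - m)⁺) (by simpa using habove)
  have hneg := hexp.sq_mul_sum_sq_le_of_card_support_le hc ha hsym hD
    (f := fun v => (f v - m)⁻) (by simpa using hbelow)
  refine ⟨m, ?_⟩
  calc c ^ 2 * ∑ v, (f v - m) ^ 2
      = c ^ 2 * ∑ v, (f v - m)⁺ ^ 2 + c ^ 2 * ∑ v, (f v - m)⁻ ^ 2 := by
        simp only [sq_eq_sq_posPart_add_sq_negPart (_ - m), Finset.sum_add_distrib, mul_add]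
    _ ≤ D * (energy a (fun v => (f v - m)⁺) + energy a (fun v => (f v - m)⁻)) := by linarith
    _ ≤ D * energy a f := by
        rw [← energy_sub_const a f m]
        exact mul_le_mul_of_nonneg_left (energy_posPart_add_energy_negPart_le ha _) hD0

lemma Expands.poincare (hexp : Expands a c) (hc : 0 ≤ c) (ha : ∀ u v, 0 ≤ a u v)
    (hsym : ∀ u v, a u v = a v u) (hD : ∀ u, degree a u ≤ D) {f : V → ℝ} {H : ℝ}
    (hH : (∑ v, degree a v) * H = ∑ v, degree a v * f v) :
    c ^ 2 * ∑ v, degree a v * (f v - H) ^ 2 ≤ D ^ 2 * energy a f := by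
  have hdeg : ∀ u, 0 ≤ degree a u := fun u => Finset.sum_nonneg fun v _ => ha u v
  have hD0 : 0 ≤ D := (hdeg (Classical.arbitrary V)).trans (hD _)
  obtain ⟨m, hm⟩ := hexp.exists_sq_mul_sum_sq_sub_le hc ha hsym hD f
  calc c ^ 2 * ∑ v, degree a v * (f v - H) ^ 2
      ≤ c ^ 2 * ∑ v, degree a v * (f v - m) ^ 2 :=
        mul_le_mul_of_nonneg_left (sum_mul_sq_sub_mean_le (fun v _ => hdeg v) hH m) (sq_nonneg c)
    _ ≤ c ^ 2 * ∑ v, D * (f v - m) ^ 2 := by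
        gcongr with v
        exact hD v
    _ = D * (c ^ 2 * ∑ v, (f v - m) ^ 2) := by rw [← Finset.mul_sum]; ring
    _ ≤ D ^ 2 * energy a f := by
        rw [sq D, mul_assoc]
        exact mul_le_mul_of_nonneg_left hm hD0

end Poincare

end Expansion

section HittingEquations

variable {V : Type*} [Fintype V] {a : V → V → ℝ} {w : V} {k : V → ℝ} {c D δ μ ε H : ℝ}

/-- The first-step equations for the expected times `k v` that the walk with conductances `a`
takes from `v` to reach `w`, multiplied by the degrees so that no division occurs. -/
structure HittingEquations (a : V → V → ℝ) (w : V) (k : V → ℝ) : Prop where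
  zero_at : k w = 0
  laplacian_eq_degree : ∀ v ≠ w, laplacian a k v = degree a v

lemma Expands.exists_hittingEquations [DecidableEq V] (hexp : Expands a c) (hc : 0 < c)
    (ha : ∀ u v, 0 ≤ a u v) (hsym : ∀ u v, a u v = a v u) (w : V) :
    ∃ k, HittingEquations a w k := by
  let L : (V → ℝ) →ₗ[ℝ] V → ℝ :=
    { toFun := fun f v => if v = w then f w else laplacian a f v
      map_add' := fun f g => by
        ext v
        simp only [laplacian_eq, Pi.add_apply, mul_add, Finset.sum_add_distrib]
        split_ifs <;> ring
      map_smul' := fun r f => by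
        ext v
        simp only [laplacian_eq, Pi.smul_apply, smul_eq_mul, mul_left_comm _ r, ← Finset.mul_sum,
          RingHom.id_apply]
        split_ifs <;> ring }
  have hL : Function.Injective L := (injective_iff_map_eq_zero L).2 fun f hf => by
    have hw : f w = 0 := by simpa [L] using congrFun hf w
    have hoff : ∀ v ≠ w, laplacian a f v = 0 := fun v hv => by simpa [L, hv] using congrFun hf v
    have henergy : energy a f = 0 := by
      rw [energy_eq_two_mul_sum_mul_laplacian hsym, Finset.sum_eq_zero, mul_zero]
      intro u _
      rcases eq_or_ne u w with rfl | hu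
      · rw [hw, zero_mul]
      · rw [hoff u hu, mul_zero]
    ext v
    rw [hexp.eq_of_energy_eq_zero hc ha hsym henergy w v, hw, Pi.zero_apply]
  obtain ⟨k, hk⟩ := LinearMap.injective_iff_surjective.1 hL
    fun v => if v = w then 0 else degree a v
  exact ⟨k, by simpa [L] using congrFun hk w, fun v hv => by simpa [L, hv] using congrFun hk v⟩

namespace HittingEquations

lemma nonneg (h : HittingEquations a w k) (ha : ∀ u v, 0 ≤ a u v)
    (hdeg : ∀ v, 0 < degree a v) (v : V) : 0 ≤ k v := by
  obtain ⟨x, -, hmin⟩ := Finset.univ.exists_min_image k ⟨v, Finset.mem_univ v⟩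
  suffices hx : x = w from (hx ▸ h.zero_at : k x = 0).symm.le.trans (hmin v (Finset.mem_univ v))
  by_contra hxw
  have hle : laplacian a k x ≤ 0 := Finset.sum_nonpos fun u _ =>
    mul_nonpos_of_nonneg_of_nonpos (ha x u) (sub_nonpos.2 (hmin u (Finset.mem_univ u)))
  exact (hdeg x).not_ge (h.laplacian_eq_degree x hxw ▸ hle)

lemma energy_eq (h : HittingEquations a w k) (hsym : ∀ u v, a u v = a v u) :
    energy a k = 2 * ∑ v, degree a v * k v := by
  rw [energy_eq_two_mul_sum_mul_laplacian hsym]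
  congr 1
  refine Finset.sum_congr rfl fun v _ => ?_
  rcases eq_or_ne v w with rfl | hv
  · simp [h.zero_at]
  · rw [h.laplacian_eq_degree v hv, mul_comm]

lemma sum_mul_eq (h : HittingEquations a w k) (hsym : ∀ u v, a u v = a v u) :
    ∑ u, a w u * k u = ∑ v, degree a v - degree a w := by
  classical
  have hzero := sum_laplacian hsym k
  rw [← Finset.add_sum_erase _ _ (Finset.mem_univ w), laplacian_eq, h.zero_at,
    Finset.sum_congr rfl fun v hv => h.laplacian_eq_degree v (Finset.ne_of_mem_erase hv)] at hzero
  linarith [Finset.add_sum_erase Finset.univ (degree a) (Finset.mem_univ w)]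

lemma sq_degree_mul_mean_sub_le [DecidableEq V] [Nonempty V] (h : HittingEquations a w k)
    (hexp : Expands a c) (hc : 0 ≤ c) (ha : ∀ u v, 0 ≤ a u v) (ha_one : ∀ u v, a u v ≤ 1)
    (hsym : ∀ u v, a u v = a v u) (hδ : ∀ u, δ ≤ degree a u) (hδ0 : 0 ≤ δ)
    (hD : ∀ u, degree a u ≤ D) (hH : (∑ v, degree a v) * H = ∑ v, degree a v * k v) :
    δ * c ^ 2 * (degree a w * H - (∑ v, degree a v - degree a w)) ^ 2 ≤
      2 * degree a w * D ^ 2 * ((∑ v, degree a v) * H) := by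
  have hdw : 0 ≤ degree a w := hδ0.trans (hδ w)
  have hneighbours : degree a w * H - (∑ v, degree a v - degree a w) =
      ∑ u, a w u * (H - k u) := by
    simp only [mul_sub, Finset.sum_sub_distrib, ← Finset.sum_mul, h.sum_mul_eq hsym, degree]
  have cauchy_schwarz : (∑ u, a w u * (H - k u)) ^ 2 ≤ degree a w * ∑ u, (k u - H) ^ 2 :=
    Finset.sum_sq_le_sum_mul_sum_of_sq_le_mul _ (fun u _ => ha w u) (fun u _ => sq_nonneg _)
      fun u _ => by
        nlinarith [mul_nonneg (mul_nonneg (ha w u) (sub_nonneg.2 (ha_one w u)))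
          (sq_nonneg (k u - H))]
  have hweight : δ * ∑ u, (k u - H) ^ 2 ≤ ∑ u, degree a u * (k u - H) ^ 2 := by
    rw [Finset.mul_sum]
    exact Finset.sum_le_sum fun u _ => mul_le_mul_of_nonneg_right (hδ u) (sq_nonneg _)
  calc δ * c ^ 2 * (degree a w * H - (∑ v, degree a v - degree a w)) ^ 2
      ≤ δ * c ^ 2 * (degree a w * ∑ u, (k u - H) ^ 2) := by
        rw [hneighbours]
        gcongr
    _ = degree a w * (c ^ 2 * (δ * ∑ u, (k u - H) ^ 2)) := by ring
    _ ≤ degree a w * (c ^ 2 * ∑ u, degree a u * (k u - H) ^ 2) := by gcongr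
    _ ≤ degree a w * (D ^ 2 * energy a k) :=
        mul_le_mul_of_nonneg_left (hexp.poincare hc ha hsym hD hH) hdw
    _ = 2 * degree a w * D ^ 2 * ((∑ v, degree a v) * H) := by
        rw [h.energy_eq hsym, hH]
        ring

end HittingEquations

lemma abs_div_sub_one_le {s t η : ℝ} (hμ : 0 < μ) (hη : η ≤ 1 / 2) (hs : |s - μ| ≤ η * μ)
    (ht : |t - μ| ≤ η * μ) : |s / t - 1| ≤ 4 * η := by
  have hη0 : 0 ≤ η := nonneg_of_mul_nonneg_left ((abs_nonneg _).trans hs) hμ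
  have ht_half : μ ≤ 2 * t := by nlinarith [(abs_le.1 ht).1]
  have ht0 : 0 < t := by linarith
  rw [div_sub_one ht0.ne', abs_div, abs_of_pos ht0, div_le_iff₀ ht0]
  calc |s - t| ≤ |s - μ| + |μ - t| := abs_sub_le s μ t
    _ ≤ η * μ + η * μ := add_le_add hs (abs_sub_comm t μ ▸ ht)
    _ ≤ 4 * η * t := by linarith [mul_le_mul_of_nonneg_left ht_half hη0]

lemma abs_sub_one_le_of_sq_sub_le {x r : ℝ} (hε : 0 ≤ ε) (hε1 : ε ≤ 1) (hr : |r - 1| ≤ ε / 2)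
    (hx : (x - r) ^ 2 ≤ ε ^ 2 / 16 * x) : |x - 1| ≤ ε := by
  by_contra! hlt
  have htriangle : |x - 1| ≤ |x - r| + |r - 1| := abs_sub_le x r 1
  have hhalf : |x - 1| / 2 ≤ |x - r| := by linarith
  have hsq : (|x - 1| / 2) ^ 2 ≤ (x - r) ^ 2 := by
    rw [← sq_abs (x - r)]
    exact pow_le_pow_left₀ (by positivity) hhalf 2
  have hε_sq : ε ^ 2 < |x - 1| ^ 2 := pow_lt_pow_left₀ hlt hε two_ne_zero
  have hε_sq_mul : ε ^ 2 * |x - 1| ≤ |x - 1| ^ 2 := by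
    rw [sq |x - 1|]
    exact mul_le_mul_of_nonneg_right (by nlinarith) (abs_nonneg _)
  linarith [mul_le_mul_of_nonneg_left (le_abs_self (x - 1)) (sq_nonneg ε), sq_nonneg ε]

namespace HittingEquations

variable [DecidableEq V] [Nonempty V]

lemma sq_mean_div_card_sub_le (h : HittingEquations a w k) (hexp : Expands a c) (hc : 0 ≤ c)
    (ha : ∀ u v, 0 ≤ a u v) (ha_one : ∀ u v, a u v ≤ 1) (hsym : ∀ u v, a u v = a v u) {η : ℝ}
    (hμ : 0 < μ) (hη : η ≤ 1 / 16) (hreg : ∀ u, |degree a u - μ| ≤ η * μ)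
    (hH : (∑ v, degree a v) * H = ∑ v, degree a v * k v) :
    c ^ 2 * (H / Fintype.card V -
        ((∑ v, degree a v) / Fintype.card V / degree a w - 1 / Fintype.card V)) ^ 2 ≤
      3 * μ * (H / Fintype.card V) := by
  set n : ℝ := (Fintype.card V : ℝ)
  set vol := ∑ v, degree a v
  set t := degree a w
  have hn : 0 < n := Nat.cast_pos.2 Fintype.card_pos
  have hη0 : 0 ≤ η := nonneg_of_mul_nonneg_left ((abs_nonneg _).trans (hreg w)) hμ
  have hδ : ∀ u, (1 - η) * μ ≤ degree a u := fun u => by linarith [(abs_le.1 (hreg u)).1]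
  have hD : ∀ u, degree a u ≤ (1 + η) * μ := fun u => by linarith [(abs_le.1 (hreg u)).2]
  have hδ0 : 0 < (1 - η) * μ := mul_pos (by linarith) hμ
  have ht : 0 < t := hδ0.trans_le (hδ w)
  have hvol_le : vol / n ≤ (1 + η) * μ := by
    rw [div_le_iff₀' hn]
    simpa [vol, n] using Finset.sum_le_card_nsmul Finset.univ _ _ fun u _ => hD u
  have hvol : 0 < vol :=
    Finset.sum_pos (fun u _ => hδ0.trans_le (hδ u)) Finset.univ_nonempty
  have hH0 : 0 ≤ H := nonneg_of_mul_nonneg_right (a := vol) (hH ▸ Finset.sum_nonneg fun v _ =>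
    mul_nonneg (hδ0.le.trans (hδ v)) (h.nonneg ha (fun u => hδ0.trans_le (hδ u)) v)) hvol
  have hnum : 2 * ((1 + η) * μ) ^ 2 * (vol / n) ≤ 3 * μ * ((1 - η) * μ) * t := by
    have hη_cubic : 2 * (1 + η) ^ 3 ≤ 3 * (1 - η) ^ 2 := by nlinarith [pow_nonneg hη0 2]
    calc 2 * ((1 + η) * μ) ^ 2 * (vol / n) ≤ 2 * ((1 + η) * μ) ^ 2 * ((1 + η) * μ) := by gcongr
      _ = 2 * (1 + η) ^ 3 * μ ^ 3 := by ring
      _ ≤ 3 * (1 - η) ^ 2 * μ ^ 3 := by gcongr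
      _ = 3 * μ * ((1 - η) * μ) * ((1 - η) * μ) := by ring
      _ ≤ 3 * μ * ((1 - η) * μ) * t := by gcongr; exact hδ w
  have hscaled := h.sq_degree_mul_mean_sub_le hexp hc ha ha_one hsym hδ hδ0.le hD hH
  refine le_of_mul_le_mul_left (a := (1 - η) * μ * (n * t) ^ 2) ?_ (by positivity)
  calc (1 - η) * μ * (n * t) ^ 2 * (c ^ 2 * (H / n - (vol / n / t - 1 / n)) ^ 2)
      = (1 - η) * μ * c ^ 2 * (t * H - (vol - t)) ^ 2 := by field_simp
    _ ≤ 2 * t * ((1 + η) * μ) ^ 2 * (vol * H) := hscaled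
    _ = 2 * ((1 + η) * μ) ^ 2 * (vol / n) * (n ^ 2 * t * (H / n)) := by field_simp
    _ ≤ 3 * μ * ((1 - η) * μ) * t * (n ^ 2 * t * (H / n)) := by gcongr
    _ = (1 - η) * μ * (n * t) ^ 2 * (3 * μ * (H / n)) := by ring

theorem abs_mean_div_card_sub_one_le (h : HittingEquations a w k) (hexp : Expands a c)
    (hc : 0 < c) (ha : ∀ u v, 0 ≤ a u v) (ha_one : ∀ u v, a u v ≤ 1)
    (hsym : ∀ u v, a u v = a v u) (hμ : 0 < μ) (hε : 0 ≤ ε) (hε1 : ε ≤ 1)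
    (hcard : 4 ≤ ε * Fintype.card V) (hreg : ∀ u, |degree a u - μ| ≤ ε / 16 * μ)
    (hgap : 48 * μ ≤ ε ^ 2 * c ^ 2) :
    |(∑ v, degree a v * k v) / (∑ v, degree a v) / Fintype.card V - 1| ≤ ε := by
  set n : ℝ := (Fintype.card V : ℝ)
  set vol := ∑ v, degree a v
  set H := (∑ v, degree a v * k v) / vol
  have hn : 0 < n := Nat.cast_pos.2 Fintype.card_pos
  have hvol : 0 < vol := Finset.sum_pos
    (fun u _ => by nlinarith [(abs_le.1 (hreg u)).1]) Finset.univ_nonempty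
  have hvol_mean : |vol / n - μ| ≤ ε / 16 * μ := by
    have hsum : vol - n * μ = ∑ v, (degree a v - μ) := by simp [vol, n]
    rw [div_sub' hn.ne', abs_div, abs_of_pos hn, div_le_iff₀' hn, hsum]
    exact (Finset.abs_sum_le_sum_abs _ _).trans <| by
      simpa [n] using Finset.sum_le_card_nsmul Finset.univ _ _ fun u _ => hreg u
  have hratio : |vol / n / degree a w - 1 / n - 1| ≤ ε / 2 := by
    have hn_inv : |1 / n| ≤ ε / 4 := by
      rw [abs_of_pos (one_div_pos.2 hn), div_le_iff₀ hn]
      linarith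
    have hdiv := abs_div_sub_one_le hμ (by linarith) hvol_mean (hreg w)
    rw [sub_right_comm]
    linarith [abs_sub (vol / n / degree a w - 1) (1 / n)]
  have hsq := h.sq_mean_div_card_sub_le hexp hc.le ha ha_one hsym hμ (by linarith) hreg
    (mul_div_cancel₀ _ hvol.ne')
  refine abs_sub_one_le_of_sq_sub_le hε hε1 hratio (le_of_mul_le_mul_left ?_ (pow_pos hc 2))
  have hmean_nonneg : 0 ≤ H / n :=
    nonneg_of_mul_nonneg_right ((by positivity : (0 : ℝ) ≤ _).trans hsq) (by positivity)
  linarith [mul_le_mul_of_nonneg_right hgap hmean_nonneg]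

end HittingEquations

end HittingEquations

section Trajectory

variable {X : ℕ → Type*} [∀ n, MeasurableSpace (X n)]
  {κ : ∀ n, Kernel (Π i : Finset.Iic n, X i) (X (n + 1))} [∀ n, IsMarkovKernel (κ n)]

lemma lintegral_traj_frestrictLe {a : ℕ} (x₀ : Π i : Finset.Iic a, X i)
    {F : (Π i : Finset.Iic a, X i) → ℝ≥0∞} (hF : Measurable F) :
    ∫⁻ x, F (Preorder.frestrictLe a x) ∂(Kernel.traj κ a x₀) = F x₀ := by
  rw [← lintegral_map hF (by fun_prop), Kernel.traj_map_frestrictLe_apply, Kernel.partialTraj_self,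
    Kernel.id_apply, lintegral_dirac' _ hF]

lemma lintegral_traj_mul_succ {a t : ℕ} (hat : a ≤ t) (x₀ : Π i : Finset.Iic a, X i)
    {F : (Π i : Finset.Iic t, X i) → ℝ≥0∞} (hF : Measurable F) {ψ : X (t + 1) → ℝ≥0∞}
    (hψ : Measurable ψ) :
    ∫⁻ x, F (Preorder.frestrictLe t x) * ψ (x (t + 1)) ∂(Kernel.traj κ a x₀) =
      ∫⁻ x, F (Preorder.frestrictLe t x) * ∫⁻ u, ψ u ∂(κ t (Preorder.frestrictLe t x))
        ∂(Kernel.traj κ a x₀) := by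
  have hF_mul : Measurable fun z : (Π i : Finset.Iic t, X i) × X (t + 1) => F z.1 * ψ z.2 := by
    fun_prop
  have hF_int : Measurable fun y => F y * ∫⁻ u, ψ u ∂(κ t y) :=
    hF.mul hψ.lintegral_kernel
  rw [← lintegral_map (g := fun x => (Preorder.frestrictLe t x, x (t + 1))) hF_mul (by fun_prop),
    ← lintegral_map (g := Preorder.frestrictLe t) hF_int (by fun_prop),
    ← Kernel.partialTraj_compProd_eq_map_traj hat, Kernel.traj_map_frestrictLe_apply,
    Measure.lintegral_compProd hF_mul]
  exact lintegral_congr fun y => lintegral_const_mul (F y) hψ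

end Trajectory

section Walk

variable {N : ℕ} {ω : Config N} {v w : Fin N} {t : ℕ} {φ ψ : Fin N → ℝ≥0∞}

lemma lintegral_step (h : (nbrs ω v).Nonempty) (ψ : Fin N → ℝ≥0∞) :
    ∫⁻ u, ψ u ∂(step ω v) = (∑ u ∈ nbrs ω v, ψ u) / deg ω v := by
  rw [step, if_neg h.ne_empty, lintegral_fintype, ENNReal.div_eq_inv_mul, Finset.mul_sum,
    ← Finset.sum_subset (nbrs ω v).subset_univ]
  · refine Finset.sum_congr rfl fun u hu => ?_
    rw [← Finset.coe_singleton, uniformOn_apply_finset, Finset.inter_singleton_of_mem hu,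
      Finset.card_singleton, Nat.cast_one, one_div, mul_comm]
    rfl
  · intro u _ hu
    rw [← Finset.coe_singleton, uniformOn_apply_finset, Finset.inter_singleton_of_notMem hu]
    simp

/-- The indicator that the path `y` has not been at `w` up to time `t`. -/
def avoids (w : Fin N) (t : ℕ) (y : Π _ : Finset.Iic t, Fin N) : ℝ≥0∞ :=
  if ∀ j, y j ≠ w then 1 else 0

lemma avoids_frestrictLe (w : Fin N) (t : ℕ) (x : ℕ → Fin N) :
    avoids w t (Preorder.frestrictLe t x) = if ∀ j ≤ t, x j ≠ w then 1 else 0 := by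
  simp [avoids]

lemma hittingTime_eq_tsum (w : Fin N) (x : ℕ → Fin N) :
    hittingTime w x = ∑' t, avoids w t (Preorder.frestrictLe t x) := by
  simp only [avoids_frestrictLe]
  by_cases h : ∃ t, x t = w
  · classical
    have hlt : ∀ t, (∀ j ≤ t, x j ≠ w) ↔ t ∈ Finset.range (Nat.find h) := fun t => by
      rw [Finset.mem_range, Nat.lt_find_iff]
    simp only [hlt]
    rw [tsum_eq_sum (s := Finset.range (Nat.find h)) fun t ht => if_neg ht,
      Finset.sum_congr rfl fun t ht => if_pos ht, Finset.sum_const, Finset.card_range, nsmul_one]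
    exact le_antisymm (iInf₂_le (Nat.find h) (Nat.find_spec h))
      (le_iInf₂ fun t ht => by exact_mod_cast Nat.find_min' h ht)
  · push Not at h
    simp [hittingTime, h]

/-- The expectation of `ψ` at time `t` under the walk started at `v` and killed when it
reaches `w`. -/
noncomputable def killedMean (ω : Config N) (v w : Fin N) (ψ : Fin N → ℝ≥0∞) (t : ℕ) : ℝ≥0∞ :=
  ∫⁻ x, avoids w t (Preorder.frestrictLe t x) * ψ (x t) ∂(walkLaw ω v)

lemma measurable_avoids (w : Fin N) (t : ℕ) :
    Measurable fun x : ℕ → Fin N => avoids w t (Preorder.frestrictLe t x) :=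
  (measurable_of_countable (avoids w t)).comp (Preorder.measurable_frestrictLe t)

lemma expHit_eq_tsum_killedMean (ω : Config N) (v w : Fin N) :
    expHit ω v w = ∑' t, killedMean ω v w 1 t := by
  simp only [expHit, killedMean, Pi.one_apply, mul_one]
  rw [lintegral_congr (hittingTime_eq_tsum w),
    lintegral_tsum fun t => (measurable_avoids w t).aemeasurable]

lemma killedMean_zero (hψ : ψ w = 0) : killedMean ω v w ψ 0 = ψ v := by
  have h := lintegral_traj_frestrictLe (X := fun _ => Fin N) (κ := walkKernel ω) (fun _ => v)
    (measurable_of_countable fun y : Π _ : Finset.Iic 0, Fin N => ψ (y ⟨0, by simp⟩))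
  refine (lintegral_congr fun x => ?_).trans h
  by_cases hx : x 0 = w <;> simp [avoids_frestrictLe, hx, hψ]

lemma killedMean_succ (hψ : ψ w = 0) :
    killedMean ω v w ψ (t + 1) = killedMean ω v w (fun u => ∫⁻ z, ψ z ∂(step ω u)) t := by
  have hmarkov := lintegral_traj_mul_succ (X := fun _ => Fin N) (κ := walkKernel ω) t.zero_le
    (fun _ => v) (measurable_of_countable (avoids w t)) (measurable_of_countable ψ)
  refine (lintegral_congr fun x => ?_).trans hmarkov
  by_cases hx : x (t + 1) = w
  · simp [hx, hψ]
  · simp [avoids_frestrictLe, hx, Nat.le_succ_iff, or_imp, forall_and]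

lemma killedMean_congr (h : ∀ u ≠ w, φ u = ψ u) :
    killedMean ω v w φ t = killedMean ω v w ψ t := by
  refine lintegral_congr fun x => ?_
  by_cases hx : x t = w
  · have : avoids w t (Preorder.frestrictLe t x) = 0 := if_neg fun h => h ⟨t, by simp⟩ hx
    simp [this]
  · rw [h _ hx]

lemma killedMean_add (φ ψ : Fin N → ℝ≥0∞) :
    killedMean ω v w (φ + ψ) t = killedMean ω v w φ t + killedMean ω v w ψ t := by
  simp only [killedMean, Pi.add_apply, mul_add]
  exact lintegral_add_left ((measurable_avoids w t).mul
    ((measurable_of_countable φ).comp (measurable_pi_apply t))) _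

lemma killedMean_le_mul_sum (ψ : Fin N → ℝ≥0∞) :
    killedMean ω v w ψ t ≤ killedMean ω v w 1 t * ∑ u, ψ u := by
  simp only [killedMean, Pi.one_apply, mul_one]
  rw [← lintegral_mul_const _ (measurable_avoids w t)]
  gcongr with x
  exact Finset.single_le_sum (f := ψ) (fun _ _ => zero_le) (Finset.mem_univ _)

lemma eq_sum_killedMean_add (hψw : ψ w = 0) (hψ : ∀ u ≠ w, ψ u = 1 + ∫⁻ z, ψ z ∂(step ω u))
    (v : Fin N) (t : ℕ) :
    ψ v = ∑ s ∈ Finset.range t, killedMean ω v w 1 s + killedMean ω v w ψ t := by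
  induction t with
  | zero => simp [killedMean_zero hψw]
  | succ t ih =>
    rw [Finset.sum_range_succ, add_assoc, killedMean_succ hψw, ← killedMean_add]
    exact ih.trans (congrArg _ (killedMean_congr hψ))

lemma expHit_eq (hψ_fin : ∀ u, ψ u ≠ ∞) (hψw : ψ w = 0)
    (hψ : ∀ u ≠ w, ψ u = 1 + ∫⁻ z, ψ z ∂(step ω u)) (v : Fin N) : expHit ω v w = ψ v := by
  have hpartial := eq_sum_killedMean_add hψw hψ v
  have htsum_le : ∑' t, killedMean ω v w 1 t ≤ ψ v := by
    rw [ENNReal.tsum_eq_iSup_nat]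
    exact iSup_le fun t => (hpartial t).symm ▸ le_self_add
  have hsurvival : Tendsto (killedMean ω v w 1) atTop (𝓝 0) :=
    ENNReal.tendsto_atTop_zero_of_tsum_ne_top (ne_top_of_le_ne_top (hψ_fin v) htsum_le)
  have hremainder : Tendsto (killedMean ω v w ψ) atTop (𝓝 0) := by
    have hbound := ENNReal.Tendsto.mul_const hsurvival
      (Or.inr (ENNReal.sum_ne_top.2 fun u _ => hψ_fin u) : (0 : ℝ≥0∞) ≠ 0 ∨ ∑ u, ψ u ≠ ∞)
    rw [zero_mul] at hbound
    exact tendsto_of_tendsto_of_tendsto_of_le_of_le tendsto_const_nhds hbound (fun _ => zero_le)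
      fun t => killedMean_le_mul_sum ψ
  have hlim := (ENNReal.tendsto_nat_tsum (killedMean ω v w 1)).add hremainder
  rw [add_zero, ← expHit_eq_tsum_killedMean] at hlim
  exact tendsto_nhds_unique hlim (tendsto_const_nhds.congr hpartial)

end Walk

section Realization

variable {N : ℕ} {ω : Config N} {w : Fin N} {k : Fin N → ℝ} {c μ ε : ℝ}

/-- The adjacency matrix of a realization, as a network with unit conductances; its degrees and
hitting time equations are those of simple random walk on the realization. -/
def adj (ω : Config N) (u v : Fin N) : ℝ := if ω s(u, v) = true then 1 else 0

lemma adj_nonneg (ω : Config N) (u v : Fin N) : 0 ≤ adj ω u v := by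
  unfold adj; split_ifs <;> norm_num

lemma adj_le_one (ω : Config N) (u v : Fin N) : adj ω u v ≤ 1 := by
  unfold adj; split_ifs <;> norm_num

lemma adj_symm (ω : Config N) (u v : Fin N) : adj ω u v = adj ω v u := by
  unfold adj; rw [Sym2.eq_swap]

lemma sum_adj_mul (ω : Config N) (v : Fin N) (f : Fin N → ℝ) :
    ∑ u, adj ω v u * f u = ∑ u ∈ nbrs ω v, f u := by
  simp [adj, nbrs, Finset.sum_filter]

lemma degree_adj (ω : Config N) (v : Fin N) : degree (adj ω) v = deg ω v := by
  simpa [deg, degree] using sum_adj_mul ω v fun _ => 1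

lemma connected_of_expands [Nonempty (Fin N)] (hexp : Expands (adj ω) c) (hc : 0 < c) :
    (graph ω).Connected := by
  classical
  refine SimpleGraph.Connected.mk fun x y => ?_
  have hcomponent : ({v | (graph ω).Reachable x v} : Finset (Fin N)) = Finset.univ := by
    refine hexp.eq_univ_of_cut_eq_zero hc (adj_symm ω) ⟨x, by simp⟩ ?_
    refine Finset.sum_eq_zero fun u hu => Finset.sum_eq_zero fun v hv => if_neg fun huv => ?_
    simp only [Finset.mem_compl, Finset.mem_filter_univ] at hu hv
    exact hv (hu.trans (SimpleGraph.Adj.reachable ⟨fun h => hv (h ▸ hu), huv⟩))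
  exact (Finset.mem_filter_univ y).1 (hcomponent.ge (Finset.mem_univ y))

lemma HittingEquations.expHit_eq_ofReal (h : HittingEquations (adj ω) w k)
    (hdeg : ∀ v, 0 < degree (adj ω) v) (v : Fin N) : expHit ω v w = ENNReal.ofReal (k v) := by
  have hk : ∀ u, 0 ≤ k u := h.nonneg (adj_nonneg ω) hdeg
  refine expHit_eq (ψ := fun u => ENNReal.ofReal (k u)) (fun u => ENNReal.ofReal_ne_top)
    (by rw [h.zero_at, ENNReal.ofReal_zero]) (fun u hu => ?_) v
  have hdeg_u : (0 : ℝ) < deg ω u := degree_adj ω u ▸ hdeg u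
  have hstep : k u = 1 + (∑ z ∈ nbrs ω u, k z) / deg ω u := by
    have heq := h.laplacian_eq_degree u hu
    rw [laplacian_eq, degree_adj, sum_adj_mul] at heq
    field_simp
    linarith
  rw [lintegral_step (Finset.card_pos.1 (Nat.cast_pos.1 hdeg_u)),
    ← ENNReal.ofReal_sum_of_nonneg fun z _ => hk z, ← ENNReal.ofReal_natCast,
    ← ENNReal.ofReal_div_of_pos hdeg_u, ← ENNReal.ofReal_one,
    ← ENNReal.ofReal_add zero_le_one
      (div_nonneg (Finset.sum_nonneg fun z _ => hk z) hdeg_u.le), ← hstep]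

lemma HittingEquations.avgHit_eq_ofReal (h : HittingEquations (adj ω) w k)
    (hdeg : ∀ v, 0 < degree (adj ω) v) :
    avgHit ω w = ENNReal.ofReal
      ((∑ v, degree (adj ω) v * k v) / ∑ v, degree (adj ω) v) := by
  have hk : ∀ u, 0 ≤ k u := h.nonneg (adj_nonneg ω) hdeg
  have hvol : 0 < ∑ v, degree (adj ω) v :=
    Finset.sum_pos (fun v _ => hdeg v) ⟨w, Finset.mem_univ w⟩
  have hterm : ∀ v, statDist ω v * expHit ω v w =
      ENNReal.ofReal (degree (adj ω) v / (∑ u, degree (adj ω) u) * k v) := fun v => by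
    rw [ENNReal.ofReal_mul (div_nonneg (hdeg v).le hvol.le), ENNReal.ofReal_div_of_pos hvol,
      ENNReal.ofReal_sum_of_nonneg fun u _ => (hdeg u).le, h.expHit_eq_ofReal hdeg]
    simp only [degree_adj, ENNReal.ofReal_natCast, statDist]
  rw [avgHit, Finset.sum_congr rfl fun v _ => hterm v, ← ENNReal.ofReal_sum_of_nonneg
    fun v _ => mul_nonneg (div_nonneg (hdeg v).le hvol.le) (hk v), Finset.sum_div]
  simp only [div_mul_eq_mul_div]

theorem connected_and_avgHit_of_expands (hexp : Expands (adj ω) c) (hc : 0 < c) (hμ : 0 < μ)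
    (hε : 0 ≤ ε) (hε1 : ε ≤ 1) (hN : 4 ≤ ε * N)
    (hreg : ∀ v, |degree (adj ω) v - μ| ≤ ε / 16 * μ) (hgap : 48 * μ ≤ ε ^ 2 * c ^ 2) :
    (graph ω).Connected ∧
      ∀ w, avgHit ω w ≠ ∞ ∧ |(avgHit ω w).toReal / N - 1| ≤ ε := by
  have hN0 : N ≠ 0 := by
    rintro rfl
    norm_num at hN
  have : Nonempty (Fin N) := Fin.pos_iff_nonempty.1 (Nat.pos_of_ne_zero hN0)
  have hdeg : ∀ v, 0 < degree (adj ω) v := fun v => by nlinarith [(abs_le.1 (hreg v)).1]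
  refine ⟨connected_of_expands hexp hc, fun w => ?_⟩
  obtain ⟨k, h⟩ := hexp.exists_hittingEquations hc (adj_nonneg ω) (adj_symm ω) w
  have hmean := h.abs_mean_div_card_sub_one_le hexp hc (adj_nonneg ω) (adj_le_one ω) (adj_symm ω)
    hμ hε hε1 (by simpa using hN) hreg hgap
  rw [h.avgHit_eq_ofReal hdeg, ENNReal.toReal_ofReal (div_nonneg
    (Finset.sum_nonneg fun v _ => mul_nonneg (hdeg v).le (h.nonneg (adj_nonneg ω) hdeg v))
    (Finset.sum_nonneg fun v _ => (hdeg v).le))]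
  exact ⟨ENNReal.ofReal_ne_top, by simpa using hmean⟩

end Realization

section Concentration

variable {ι : Type*} [Fintype ι]

/-- The law of independent Bernoulli variables with success probabilities `r`. -/
noncomputable abbrev bernoulliPi (r : ι → unitInterval) : Measure (ι → Bool) :=
  Measure.pi fun e => bernoulliMeasure true false (r e)

/-- The number of successes among the indices in `E`, as a real random variable. -/
def successes (E : Finset ι) (ω : ι → Bool) : ℝ := ∑ e ∈ E, if ω e = true then 1 else 0

variable (r : ι → unitInterval) (E : Finset ι) {η t : ℝ}

lemma mgf_successes :
    mgf (successes E) (bernoulliPi r) t = ∏ e ∈ E, (1 + (r e : ℝ) * (Real.exp t - 1)) := by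
  classical
  set f : ι → Bool → ℝ := fun e b => if e ∈ E ∧ b = true then Real.exp t else 1 with hf
  have hfactor : ∀ ω : ι → Bool, Real.exp (t * successes E ω) = ∏ e, f e (ω e) := fun ω => by
    rw [successes, Finset.mul_sum, Real.exp_sum,
      ← Finset.prod_subset E.subset_univ fun e _ he => by simp [hf, he]]
    refine Finset.prod_congr rfl fun e he => ?_
    by_cases hω : ω e = true <;> simp [hf, he, hω]
  rw [mgf, integral_congr_ae (Eventually.of_forall hfactor)]
  refine (integral_fintype_prod_eq_prod f).trans ?_
  rw [← Finset.prod_subset E.subset_univ fun e _ he => by simp [hf, he]]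
  refine Finset.prod_congr rfl fun e he => ?_
  rw [integral_bernoulliMeasure]
  simp only [hf, he, true_and, ite_true, Bool.false_eq_true, ite_false, smul_eq_mul]
  ring

lemma mgf_successes_le (ht : |t| ≤ 1) :
    mgf (successes E) (bernoulliPi r) t ≤ Real.exp ((t + t ^ 2) * ∑ e ∈ E, (r e : ℝ)) := by
  rw [mgf_successes, Finset.mul_sum, Real.exp_sum]
  refine Finset.prod_le_prod (fun e _ => ?_) fun e _ => ?_
  · nlinarith [(r e).2.1, (r e).2.2, Real.exp_pos t]
  · have hexp : Real.exp t - 1 ≤ t + t ^ 2 := by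
      linarith [(abs_le.1 (Real.abs_exp_sub_one_sub_id_le ht)).2]
    calc 1 + (r e : ℝ) * (Real.exp t - 1) ≤ (t + t ^ 2) * r e + 1 := by
          linarith [mul_le_mul_of_nonneg_left hexp (r e).2.1]
      _ ≤ Real.exp ((t + t ^ 2) * r e) := Real.add_one_le_exp _

lemma measure_le_successes_le (hη : 0 ≤ η) (hη1 : η ≤ 1) :
    (bernoulliPi r).real {ω | (1 + η) * ∑ e ∈ E, (r e : ℝ) ≤ successes E ω} ≤
      Real.exp (-(η ^ 2 / 4 * ∑ e ∈ E, (r e : ℝ))) := by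
  refine (measure_ge_le_exp_mul_mgf _ (t := η / 2) (by positivity) .of_finite).trans
    ((mul_le_mul_of_nonneg_left (mgf_successes_le r E (by rw [abs_le]; constructor <;> linarith))
      (Real.exp_nonneg _)).trans_eq ?_)
  rw [← Real.exp_add]
  ring_nf

lemma measure_successes_le_le (hη : 0 ≤ η) (hη1 : η ≤ 1) :
    (bernoulliPi r).real {ω | successes E ω ≤ (1 - η) * ∑ e ∈ E, (r e : ℝ)} ≤
      Real.exp (-(η ^ 2 / 4 * ∑ e ∈ E, (r e : ℝ))) := by
  refine (measure_le_le_exp_mul_mgf _ (t := -(η / 2)) (by linarith) .of_finite).trans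
    ((mul_le_mul_of_nonneg_left (mgf_successes_le r E (by rw [abs_le]; constructor <;> linarith))
      (Real.exp_nonneg _)).trans_eq ?_)
  rw [← Real.exp_add]
  ring_nf

lemma measure_lt_abs_successes_sub_le (hη : 0 ≤ η) (hη1 : η ≤ 1) :
    (bernoulliPi r).real
        {ω | η * ∑ e ∈ E, (r e : ℝ) < |successes E ω - ∑ e ∈ E, (r e : ℝ)|} ≤
      2 * Real.exp (-(η ^ 2 / 4 * ∑ e ∈ E, (r e : ℝ))) := by
  rw [two_mul]
  refine (measureReal_mono fun ω hω => ?_).trans ((measureReal_union_le _ _).trans (add_le_add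
    (measure_le_successes_le r E hη hη1) (measure_successes_le_le r E hη hη1)))
  rcases lt_abs.1 (Set.mem_ofPred.1 hω) with h | h
  · exact Or.inl (Set.mem_ofPred.2 (by linarith))
  · exact Or.inr (Set.mem_ofPred.2 (by linarith))

end Concentration

section RandomGraph

variable {V : Type*} [Fintype V] [DecidableEq V]

/-- The pairs that contain `v`, including the loop at `v`. -/
def incidentPairs (v : V) : Finset (Sym2 V) := Finset.univ.image fun w => s(v, w)

/-- The pairs that are separated by `S`. -/
def boundary (S : Finset V) : Finset (Sym2 V) := (S ×ˢ Sᶜ).image fun z => s(z.1, z.2)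

lemma sum_incidentPairs (v : V) (f : Sym2 V → ℝ) :
    ∑ e ∈ incidentPairs v, f e = ∑ w, f s(v, w) :=
  Finset.sum_image fun _ _ _ _ h => Sym2.congr_right.1 h

lemma sum_boundary (S : Finset V) (f : Sym2 V → ℝ) :
    ∑ e ∈ boundary S, f e = cut (fun u v => f s(u, v)) S := by
  rw [boundary, Finset.sum_image, Finset.sum_product, cut]
  rintro ⟨u, v⟩ h ⟨u', v'⟩ h' heq
  simp only [Finset.coe_product, Set.mem_prod, Finset.mem_coe, Finset.mem_compl] at h h'
  rcases Sym2.eq_iff.1 heq with ⟨rfl, rfl⟩ | ⟨rfl, rfl⟩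
  · rfl
  · exact absurd h.1 h'.2

lemma sum_pow_card_erase_empty (x : ℝ) :
    ∑ S ∈ (Finset.univ : Finset (Finset V)).erase ∅, x ^ #S = (x + 1) ^ Fintype.card V - 1 := by
  have hbinomial := Fintype.sum_pow_mul_eq_add_pow V x 1
  simp only [one_pow, mul_one] at hbinomial
  rw [← hbinomial, ← Finset.add_sum_erase _ _ (Finset.mem_univ (∅ : Finset V)), Finset.card_empty,
    pow_zero, add_sub_cancel_left]

variable {N : ℕ} {r : Sym2 (Fin N) → unitInterval} {μ m η ε : ℝ}

/-- The expectation of the adjacency matrix of the random graph in which the pair `e` is an edge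
with probability `r e`. -/
def meanAdj (r : Sym2 (Fin N) → unitInterval) (u v : Fin N) : ℝ := r s(u, v)

lemma measure_not_nearRegular_le (hdeg : ∀ v, degree (meanAdj r) v = μ) (hη : 0 ≤ η)
    (hη1 : η ≤ 1) :
    (bernoulliPi r).real {ω | ∃ v, η * μ < |degree (adj ω) v - μ|} ≤
      2 * (N * Real.exp (-(η ^ 2 / 4 * μ))) := by
  have hvertex : ∀ v, (bernoulliPi r).real {ω | η * μ < |degree (adj ω) v - μ|} ≤
      2 * Real.exp (-(η ^ 2 / 4 * μ)) := fun v => by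
    have hmean : ∑ e ∈ incidentPairs v, (r e : ℝ) = μ := (sum_incidentPairs v _).trans (hdeg v)
    have hsucc : ∀ ω, successes (incidentPairs v) ω = degree (adj ω) v := fun ω =>
      sum_incidentPairs v _
    simpa only [hmean, hsucc] using measure_lt_abs_successes_sub_le r (incidentPairs v) hη hη1
  calc (bernoulliPi r).real {ω | ∃ v, η * μ < |degree (adj ω) v - μ|}
      = (bernoulliPi r).real (⋃ v, {ω | η * μ < |degree (adj ω) v - μ|}) := by
        rw [Set.ofPred_exists]
    _ ≤ ∑ v, (bernoulliPi r).real {ω | η * μ < |degree (adj ω) v - μ|} :=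
        measureReal_iUnion_fintype_le _
    _ ≤ ∑ _v : Fin N, 2 * Real.exp (-(η ^ 2 / 4 * μ)) :=
        Finset.sum_le_sum fun v _ => hvertex v
    _ = 2 * (N * Real.exp (-(η ^ 2 / 4 * μ))) := by
        rw [Finset.sum_const, Finset.card_univ, Fintype.card_fin, nsmul_eq_mul]
        ring

lemma measure_not_expands_le (hexp : Expands (meanAdj r) m) :
    (bernoulliPi r).real {ω | ¬ Expands (adj ω) (m / 2)} ≤
      Real.exp (N * Real.exp (-(m / 16))) - 1 := by
  have hset : ∀ S : Finset (Fin N),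
      (bernoulliPi r).real {ω | 2 * #S ≤ N ∧ cut (adj ω) S < m / 2 * #S} ≤
        Real.exp (-(m / 16)) ^ #S := fun S => by
    by_cases hcard : 2 * #S ≤ N
    · have hmean : m * #S ≤ ∑ e ∈ boundary S, (r e : ℝ) :=
        (hexp S (by simpa using hcard)).trans_eq (sum_boundary S fun e => (r e : ℝ)).symm
      refine (measureReal_mono ?_).trans ((measure_successes_le_le r (boundary S) (η := 1 / 2)
        (by norm_num) (by norm_num)).trans ?_)
      · rintro ω ⟨-, hω⟩
        have hsucc : successes (boundary S) ω = cut (adj ω) S := sum_boundary S _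
        rw [Set.mem_ofPred_eq, hsucc]
        linarith
      · rw [← Real.exp_nat_mul]
        exact Real.exp_le_exp.2 (by linarith)
    · simp only [hcard, false_and, Set.ofPred_false, measureReal_empty]
      positivity
  have hunion : {ω | ¬ Expands (adj ω) (m / 2)} ⊆ ⋃ S ∈ Finset.univ.erase (∅ : Finset (Fin N)),
      {ω | 2 * #S ≤ N ∧ cut (adj ω) S < m / 2 * #S} := fun ω hω => by
    obtain ⟨S, hcard, hcut⟩ : ∃ S : Finset (Fin N), 2 * #S ≤ N ∧ cut (adj ω) S < m / 2 * #S := by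
      simpa [Expands] using hω
    have hS : S ≠ ∅ := by
      rintro rfl
      simp [cut] at hcut
    exact Set.mem_iUnion₂.2 ⟨S, Finset.mem_erase.2 ⟨hS, Finset.mem_univ S⟩, hcard, hcut⟩
  calc (bernoulliPi r).real {ω | ¬ Expands (adj ω) (m / 2)}
      ≤ ∑ S ∈ Finset.univ.erase (∅ : Finset (Fin N)), Real.exp (-(m / 16)) ^ #S :=
        (measureReal_mono hunion (measure_ne_top _ _)).trans
          ((measureReal_biUnion_finset_le _ _).trans (Finset.sum_le_sum fun S _ => hset S))
    _ = (Real.exp (-(m / 16)) + 1) ^ N - 1 := by rw [sum_pow_card_erase_empty, Fintype.card_fin]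
    _ ≤ Real.exp (N * Real.exp (-(m / 16))) - 1 := by
        rw [Real.exp_nat_mul]
        exact sub_le_sub_right
          (pow_le_pow_left₀ (by positivity) (Real.add_one_le_exp _) N) 1

/-- The event that the graph is connected and every `H_w` is finite and within relative error `ε`
of `N`. -/
def goodEvent (N : ℕ) (ε : ℝ) : Set (Config N) :=
  {ω | (graph ω).Connected ∧ ∀ w, avgHit ω w ≠ ∞ ∧ |(avgHit ω w).toReal / N - 1| ≤ ε}

lemma goodEvent_mono {ε' : ℝ} (h : ε ≤ ε') : goodEvent N ε ⊆ goodEvent N ε' :=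
  fun _ hω => ⟨hω.1, fun w => ⟨(hω.2 w).1, (hω.2 w).2.trans h⟩⟩

lemma measure_goodEvent_compl_le (hdeg : ∀ v, degree (meanAdj r) v = μ)
    (hexp : Expands (meanAdj r) m) (hμ : 0 < μ) (hm : 0 < m) (hε : 0 ≤ ε) (hε1 : ε ≤ 1)
    (hN : 4 ≤ ε * N) (hgap : 192 * μ ≤ ε ^ 2 * m ^ 2) :
    (bernoulliPi r).real (goodEvent N ε)ᶜ ≤
      2 * (N * Real.exp (-((ε / 16) ^ 2 / 4 * μ))) +
        (Real.exp (N * Real.exp (-(m / 16))) - 1) := by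
  refine (measureReal_mono fun ω hω => ?_).trans ((measureReal_union_le _ _).trans (add_le_add
    (measure_not_nearRegular_le hdeg (by linarith) (by linarith)) (measure_not_expands_le hexp)))
  by_contra hnot
  simp only [Set.mem_union, Set.mem_ofPred_eq, not_or, not_exists, not_lt, not_not] at hnot
  exact hω (connected_and_avgHit_of_expands hnot.2 (half_pos hm) hμ hε hε1 hN hnot.1
    (by linarith))

end RandomGraph

lemma tendsto_mul_exp_neg {α : Type*} {l : Filter α} {x f : α → ℝ} (hx : Tendsto x l atTop)
    (hf : ∀ᶠ i in l, 0 ≤ f i) (hlog : (fun i => Real.log (x i)) =o[l] f) :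
    Tendsto (fun i => x i * Real.exp (-f i)) l (𝓝 0) := by
  refine squeeze_zero' ?_ ?_ (tendsto_inv_atTop_zero.comp hx)
  · filter_upwards [hx.eventually_ge_atTop 0] with i hi
    positivity
  · filter_upwards [hx.eventually_gt_atTop 0, hf, hlog.bound (one_half_pos)] with i hi hfi hle
    have hlog_le : 2 * Real.log (x i) ≤ f i := by
      rw [Real.norm_of_nonneg hfi] at hle
      linarith [Real.le_norm_self (Real.log (x i))]
    calc x i * Real.exp (-f i) ≤ Real.exp (Real.log (x i)) * Real.exp (-(2 * Real.log (x i))) := by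
          rw [Real.exp_log hi]
          gcongr
      _ = (x i)⁻¹ := by
          rw [← Real.exp_add, two_mul, neg_add, add_neg_cancel_left, Real.exp_neg, Real.exp_log hi]

section Asymptotics

variable {α : Type*} {l : Filter α} {N : α → ℕ} {r : ∀ i, Sym2 (Fin (N i)) → unitInterval}
  {μ m : α → ℝ} {ε : ℝ}

lemma tendsto_failure_bound (hN : Tendsto N l atTop) (hμ : ∀ᶠ i in l, 0 ≤ μ i)
    (hm : ∀ᶠ i in l, 0 ≤ m i) (hlogμ : (fun i => Real.log (N i)) =o[l] μ)
    (hlogm : (fun i => Real.log (N i)) =o[l] m) {a b : ℝ} (ha : 0 < a) (hb : 0 < b) :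
    Tendsto (fun i => 2 * (N i * Real.exp (-(a * μ i))) +
      (Real.exp (N i * Real.exp (-(m i / b))) - 1)) l (𝓝 0) := by
  have hNR : Tendsto (fun i => (N i : ℝ)) l atTop := tendsto_natCast_atTop_atTop.comp hN
  have hvertices : Tendsto (fun i => N i * Real.exp (-(a * μ i))) l (𝓝 0) :=
    tendsto_mul_exp_neg hNR (hμ.mono fun i hi => mul_nonneg ha.le hi)
      (hlogμ.const_mul_right ha.ne')
  have hcuts : Tendsto (fun i => N i * Real.exp (-(m i / b))) l (𝓝 0) := by
    simp only [div_eq_inv_mul]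
    exact tendsto_mul_exp_neg hNR (hm.mono fun i hi => mul_nonneg (inv_nonneg.2 hb.le) hi)
      (hlogm.const_mul_right (inv_ne_zero hb.ne'))
  simpa using (hvertices.const_mul 2).add
    (((Real.continuous_exp.tendsto 0).comp hcuts).sub_const 1)

lemma tendsto_measure_goodEvent_compl (hN : Tendsto N l atTop)
    (hdeg : ∀ i v, degree (meanAdj (r i)) v = μ i) (hexp : ∀ i, Expands (meanAdj (r i)) (m i))
    (hm : ∀ i, 0 ≤ m i) (hlogμ : (fun i => Real.log (N i)) =o[l] μ)
    (hlogm : (fun i => Real.log (N i)) =o[l] m) (hgap : μ =o[l] fun i => m i ^ 2) (hε : 0 < ε)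
    (hε1 : ε ≤ 1) :
    Tendsto (fun i => (bernoulliPi (r i)).real (goodEvent (N i) ε)ᶜ) l (𝓝 0) := by
  have hNR : Tendsto (fun i => (N i : ℝ)) l atTop := tendsto_natCast_atTop_atTop.comp hN
  have hμ : ∀ᶠ i in l, 0 ≤ μ i := by
    filter_upwards [hN.eventually_ge_atTop 1] with i hi
    rw [← hdeg i ⟨0, hi⟩]
    exact Finset.sum_nonneg fun w _ => (r i _).2.1
  refine squeeze_zero' (Eventually.of_forall fun i => measureReal_nonneg) ?_
    (tendsto_failure_bound (a := (ε / 16) ^ 2 / 4) hN hμ (Eventually.of_forall hm) hlogμ hlogm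
      (by positivity) (b := 16) (by norm_num))
  filter_upwards [hNR.eventually_ge_atTop (4 / ε),
    (Real.tendsto_log_atTop.comp hNR).eventually_gt_atTop 0, hμ, hlogμ.bound one_pos,
    hlogm.bound one_pos, hgap.bound (by positivity : (0 : ℝ) < ε ^ 2 / 192)]
    with i hNi (hlog : 0 < Real.log (N i)) hμi hlogμi hlogmi hgapi
  rw [Real.norm_of_nonneg hlog.le, one_mul, Real.norm_of_nonneg hμi] at hlogμi
  rw [Real.norm_of_nonneg hlog.le, one_mul, Real.norm_of_nonneg (hm i)] at hlogmi
  rw [Real.norm_of_nonneg hμi, Real.norm_of_nonneg (sq_nonneg _)] at hgapi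
  exact measure_goodEvent_compl_le (hdeg i) (hexp i) (hlog.trans_le hlogμi)
    (hlog.trans_le hlogmi) hε.le hε1 (by rwa [div_le_iff₀' hε] at hNi) (by linarith)

theorem tendsto_measure_goodEvent (hN : Tendsto N l atTop)
    (hdeg : ∀ i v, degree (meanAdj (r i)) v = μ i) (hexp : ∀ i, Expands (meanAdj (r i)) (m i))
    (hm : ∀ i, 0 ≤ m i) (hlogμ : (fun i => Real.log (N i)) =o[l] μ)
    (hlogm : (fun i => Real.log (N i)) =o[l] m) (hgap : μ =o[l] fun i => m i ^ 2) (hε : 0 < ε) :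
    Tendsto (fun i => bernoulliPi (r i) (goodEvent (N i) ε)) l (𝓝 1) := by
  have hmin : Tendsto (fun i => (bernoulliPi (r i)).real (goodEvent (N i) (min ε 1))) l (𝓝 1) := by
    have hcompl := (tendsto_measure_goodEvent_compl hN hdeg hexp hm hlogμ hlogm hgap
      (lt_min hε one_pos) (min_le_right ε 1)).const_sub 1
    simpa only [probReal_compl_eq_one_sub (Set.toFinite _).measurableSet, sub_sub_cancel,
      sub_zero] using hcompl
  have hreal : Tendsto (fun i => (bernoulliPi (r i)).real (goodEvent (N i) ε)) l (𝓝 1) :=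
    tendsto_of_tendsto_of_tendsto_of_le_of_le hmin tendsto_const_nhds
      (fun i => measureReal_mono (goodEvent_mono (min_le_left ε 1)))
      fun i => measureReal_le_one
  rw [← ENNReal.ofReal_one]
  exact (ENNReal.tendsto_ofReal hreal).congr fun i => ofReal_measureReal

end Asymptotics

section Blocks

variable {V K : Type*} [Fintype V] [DecidableEq V] [Fintype K] [DecidableEq K] {B : V → K}

lemma cut_sameBlock (B : V → K) (S : Finset V) :
    cut (fun u v => if B u = B v then (1 : ℝ) else 0) S =
      ∑ k, (#{v ∈ S | B v = k} : ℝ) * #{v ∈ Sᶜ | B v = k} := by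
  rw [cut, ← Finset.sum_fiberwise S B]
  refine Finset.sum_congr rfl fun k _ => ?_
  rw [← nsmul_eq_mul]
  refine Finset.sum_eq_card_nsmul fun u hu => ?_
  rw [(Finset.mem_filter.1 hu).2, Finset.sum_boole]
  simp only [eq_comm]

lemma card_mul_cut_sameBlock_le (hB : ∀ k, Fintype.card K * #{v | B v = k} = Fintype.card V)
    (S : Finset V) :
    Fintype.card K * cut (fun u v => if B u = B v then (1 : ℝ) else 0) S ≤ #S * #Sᶜ := by
  have hfiber : ∀ k, (Fintype.card K : ℝ) * #{v ∈ Sᶜ | B v = k} =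
      Fintype.card V - Fintype.card K * #{v ∈ S | B v = k} := fun k => by
    rw [eq_sub_iff_add_eq', ← mul_add, ← hB k, ← Finset.union_compl S, Finset.filter_union,
      Finset.card_union_of_disjoint (Finset.disjoint_filter_filter disjoint_compl_right)]
    push_cast
    rfl
  have hsum : ∑ k, (#{v ∈ S | B v = k} : ℝ) = #S := by
    exact_mod_cast (Finset.card_eq_sum_card_fiberwise fun v _ => Finset.mem_univ (B v)).symm
  have hcauchySchwarz : (#S : ℝ) ^ 2 ≤ Fintype.card K * ∑ k, (#{v ∈ S | B v = k} : ℝ) ^ 2 := by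
    rw [← hsum]
    exact sq_sum_le_card_mul_sum_sq
  have hcompl : (#S : ℝ) + #Sᶜ = Fintype.card V := by exact_mod_cast S.card_add_card_compl
  calc Fintype.card K * cut (fun u v => if B u = B v then (1 : ℝ) else 0) S
      = ∑ k, (#{v ∈ S | B v = k} : ℝ) * (Fintype.card K * #{v ∈ Sᶜ | B v = k}) := by
        rw [cut_sameBlock, Finset.mul_sum]
        exact Finset.sum_congr rfl fun k _ => mul_left_comm _ _ _
    _ = #S * Fintype.card V - Fintype.card K * ∑ k, (#{v ∈ S | B v = k} : ℝ) ^ 2 := by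
        rw [← hsum, Finset.sum_mul, Finset.mul_sum, ← Finset.sum_sub_distrib]
        exact Finset.sum_congr rfl fun k _ => by rw [hfiber]; ring
    _ ≤ #S * #Sᶜ := by
        rw [← hcompl]
        linarith

lemma expands_differentBlock (hB : ∀ k, Fintype.card K * #{v | B v = k} = Fintype.card V)
    (hK : 2 ≤ Fintype.card K) :
    Expands (fun u v => if B u = B v then (0 : ℝ) else 1) (Fintype.card V / 4) := fun S hS => by
  have hcut : cut (fun u v => if B u = B v then (0 : ℝ) else 1) S =
      #S * #Sᶜ - cut (fun u v => if B u = B v then (1 : ℝ) else 0) S := by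
    have hpairs : (#S * #Sᶜ : ℝ) = cut (fun _ _ => 1) S := by simp [cut]
    rw [hpairs]
    simp only [cut, ← Finset.sum_sub_distrib]
    refine Finset.sum_congr rfl fun u _ => Finset.sum_congr rfl fun v _ => ?_
    split_ifs <;> norm_num
  have hsame : 2 * cut (fun u v => if B u = B v then (1 : ℝ) else 0) S ≤ #S * #Sᶜ := by
    refine (mul_le_mul_of_nonneg_right (by exact_mod_cast hK) ?_).trans
      (card_mul_cut_sameBlock_le hB S)
    rw [cut_sameBlock]
    positivity
  have hcompl : (#S : ℝ) + #Sᶜ = Fintype.card V := by exact_mod_cast S.card_add_card_compl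
  have hhalf : 2 * (#S : ℝ) ≤ Fintype.card V := by exact_mod_cast hS
  nlinarith [(#S).cast_nonneg (α := ℝ)]

end Blocks

section BlockModel

/-- The expected degree of a vertex in the stochastic block model. -/
noncomputable def meanDegree (N M : ℕ) (p q : ℝ) : ℝ := (N * p + N * (M - 1) * q) / M

/-- A rate at which the expected adjacency matrix of the stochastic block model expands. With at
least two blocks the edges between different blocks suffice. -/
noncomputable def expansionRate (N M : ℕ) (p q : ℝ) : ℝ := if M = 1 then N * p / 2 else N * q / 4

lemma meanDegree_nonneg {N M : ℕ} {p q : ℝ} (hM : M ≠ 0) (hp : 0 ≤ p) (hq : 0 ≤ q) :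
    0 ≤ meanDegree N M p q := by
  have hM1 : (0 : ℝ) ≤ M - 1 :=
    sub_nonneg.2 (Nat.one_le_cast.2 (Nat.one_le_iff_ne_zero.2 hM))
  exact div_nonneg (add_nonneg (by positivity) (mul_nonneg (mul_nonneg N.cast_nonneg hM1) hq))
    M.cast_nonneg

lemma expansionRate_nonneg {N M : ℕ} {p q : ℝ} (hp : 0 ≤ p) (hq : 0 ≤ q) :
    0 ≤ expansionRate N M p q := by
  unfold expansionRate
  split_ifs <;> positivity

variable {N M : ℕ} {B : Fin N → Fin M}

lemma meanAdj_edgeProb (B : Fin N → Fin M) (p q : unitInterval) (u v : Fin N) :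
    meanAdj (edgeProb B p q) u v = if B u = B v then (p : ℝ) else q :=
  apply_ite Subtype.val _ _ _

lemma degree_meanAdj_edgeProb (hB : ∀ m, M * #{v | B v = m} = N) (p q : unitInterval)
    (v : Fin N) : degree (meanAdj (edgeProb B p q)) v = meanDegree N M p q := by
  have hM : (M : ℝ) ≠ 0 := by exact_mod_cast (Fin.pos (B v)).ne'
  have hblock : (M : ℝ) * #{w | B v = B w} = N := by
    simpa only [eq_comm] using (by exact_mod_cast hB (B v) : (M : ℝ) * #{w | B w = B v} = N)
  have hsplit : ∀ w, meanAdj (edgeProb B p q) v w =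
      q + (if B v = B w then 1 else 0) * ((p : ℝ) - q) := fun w => by
    rw [meanAdj_edgeProb]
    split_ifs <;> ring
  simp only [degree, hsplit, Finset.sum_add_distrib, ← Finset.sum_mul, Finset.sum_boole,
    Finset.sum_const, Finset.card_univ, Fintype.card_fin, nsmul_eq_mul]
  rw [meanDegree, eq_div_iff hM]
  linear_combination ((p : ℝ) - q) * hblock

lemma expands_meanAdj_edgeProb (hB : ∀ m, M * #{v | B v = m} = N) (p q : unitInterval) :
    Expands (meanAdj (edgeProb B p q)) (expansionRate N M p q) := by
  unfold expansionRate
  split_ifs with hM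
  · subst hM
    have hexp := (expands_one (V := Fin N)).mul_const p.2.1
    rw [Fintype.card_fin, div_mul_eq_mul_div] at hexp
    exact hexp.mono fun u v => by
      rw [meanAdj_edgeProb, if_pos (Subsingleton.elim _ _), one_mul]
  · obtain hM2 | hM0 : 2 ≤ M ∨ M = 0 := by omega
    · have hexp := (expands_differentBlock (B := B) (by simpa using hB)
        (by simpa using hM2)).mul_const q.2.1
      rw [Fintype.card_fin, div_mul_eq_mul_div] at hexp
      refine hexp.mono fun u v => ?_
      rw [meanAdj_edgeProb]
      split_ifs
      · simpa using p.2.1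
      · rw [one_mul]
    · subst hM0
      have := Function.isEmpty B
      intro S _
      simp [S.eq_empty_of_isEmpty, cut]

end BlockModel

section Growth

lemma mul_le_mul_sq_of_le_add {D L x y μ : ℝ} (hD : 0 ≤ D) (hL : 0 < L) (hy : 0 ≤ y)
    (hx : x * L ≤ D * y ^ 2) (hμ : μ ≤ x + y) (hμL : (D + 1) * L ≤ μ) :
    μ * L ≤ (D + 1) * y ^ 2 := by
  have hupper : μ * L ≤ D * y ^ 2 + y * L := by
    linarith [mul_le_mul_of_nonneg_right hμ hL.le]
  have hLy : L ≤ y := by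
    by_contra! hyL
    have hlower : (D + 1) * L * L ≤ μ * L := mul_le_mul_of_nonneg_right hμL hL.le
    have hsq : D * y ^ 2 ≤ D * L ^ 2 :=
      mul_le_mul_of_nonneg_left (pow_le_pow_left₀ hy hyL.le 2) hD
    linarith [mul_lt_mul_of_pos_right hyL hL]
  linarith [mul_le_mul_of_nonneg_left hLy hy]

lemma meanDegree_mul_le {N M : ℕ} {p q L C : ℝ} (hN : N ≠ 0) (hM : M ≠ 0) (hq : 0 ≤ q)
    (hL : 0 < L) (hsqrt : √(p * L / (N * M)) ≤ C * q)
    (hμ : (C ^ 2 + 1) * L ≤ meanDegree N M p q) :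
    meanDegree N M p q * L ≤ 16 * (C ^ 2 + 1) * expansionRate N M p q ^ 2 := by
  have hN' : (N : ℝ) ≠ 0 := Nat.cast_ne_zero.2 hN
  have hM' : (M : ℝ) ≠ 0 := Nat.cast_ne_zero.2 hM
  unfold expansionRate
  split_ifs with hM1
  · have hμ_eq : meanDegree N M p q = N * p := by simp [meanDegree, hM1]
    have hLμ : L ≤ meanDegree N M p q := by nlinarith [sq_nonneg C]
    rw [← hμ_eq]
    nlinarith [sq_nonneg (C * meanDegree N M p q)]
  · have hintra : N * p / M * L ≤ C ^ 2 * (N * q) ^ 2 := by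
      calc N * p / M * L = N ^ 2 * (p * L / (N * M)) := by field_simp
        _ ≤ N ^ 2 * (C * q) ^ 2 := by gcongr; exact (Real.sqrt_le_iff.1 hsqrt).2
        _ = C ^ 2 * (N * q) ^ 2 := by ring
    have hdegree : meanDegree N M p q ≤ N * p / M + N * q := by
      have hsplit : meanDegree N M p q = N * p / M + N * q - N * q / M := by
        rw [meanDegree]
        field_simp
        ring
      rw [hsplit]
      exact sub_le_self _ (by positivity)
    linarith [mul_le_mul_sq_of_le_add (sq_nonneg C) hL (by positivity) hintra hdegree hμ]

variable {α : Type*} {l : Filter α} {N M : α → ℕ} {p q L : α → ℝ}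

lemma isLittleO_meanDegree (hM : ∀ᶠ i in l, M i ≠ 0)
    (hconn : (fun i => M i * L i) =o[l] fun i => N i * p i + N i * ((M i : ℝ) - 1) * q i) :
    L =o[l] fun i => meanDegree (N i) (M i) (p i) (q i) := by
  refine (hconn.mul_isBigO (isBigO_refl (fun i => (M i : ℝ)⁻¹) l)).congr' ?_
    (Eventually.of_forall fun i => (div_eq_mul_inv _ _).symm)
  filter_upwards [hM] with i hi
  rw [mul_right_comm, mul_inv_cancel₀ (Nat.cast_ne_zero.2 hi), one_mul]

lemma isBigO_meanDegree_mul (hN : ∀ᶠ i in l, N i ≠ 0) (hM : ∀ᶠ i in l, M i ≠ 0)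
    (hp : ∀ i, 0 ≤ p i) (hq : ∀ i, 0 ≤ q i) (hL : Tendsto L l atTop)
    (hμ : L =o[l] fun i => meanDegree (N i) (M i) (p i) (q i))
    (hsqrt : (fun i => √(p i * L i / (N i * M i))) =O[l] q) :
    (fun i => meanDegree (N i) (M i) (p i) (q i) * L i) =O[l]
      fun i => expansionRate (N i) (M i) (p i) (q i) ^ 2 := by
  obtain ⟨C, hC⟩ := hsqrt.bound
  refine IsBigO.of_bound (16 * (C ^ 2 + 1)) ?_
  filter_upwards [hN, hM, hL.eventually_gt_atTop 0, hC,
    hμ.bound (by positivity : 0 < (C ^ 2 + 1)⁻¹)] with i hNi hMi hLi hCi hμi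
  have hμ0 := meanDegree_nonneg (N := N i) hMi (hp i) (hq i)
  rw [Real.norm_of_nonneg hLi.le, Real.norm_of_nonneg hμ0, ← div_eq_inv_mul,
    le_div_iff₀' (by positivity)] at hμi
  rw [Real.norm_of_nonneg (Real.sqrt_nonneg _), Real.norm_of_nonneg (hq i)] at hCi
  rw [Real.norm_of_nonneg (mul_nonneg hμ0 hLi.le), Real.norm_of_nonneg (sq_nonneg _)]
  exact meanDegree_mul_le hNi hMi (hq i) hLi hCi hμi

lemma isLittleO_of_mul_isBigO_sq {μ m : α → ℝ} (hL : Tendsto L l atTop)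
    (hμ : L =o[l] μ) (hm : (fun i => μ i * L i) =O[l] fun i => m i ^ 2) :
    L =o[l] m ∧ μ =o[l] fun i => m i ^ 2 := by
  constructor
  · have hsq := (hμ.mul_isBigO (isBigO_refl L l)).trans_isBigO hm
    exact IsLittleO.of_pow (n := 2) (hsq.congr_left fun i => (sq (L i)).symm) two_ne_zero
  · have hone : (fun _ => (1 : ℝ)) =o[l] L :=
      isLittleO_const_left.2 (Or.inr (tendsto_norm_atTop_atTop.comp hL))
    simpa only [mul_one] using ((isBigO_refl μ l).mul_isLittleO hone).trans_isBigO hm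

lemma isBigO_mul_pow_of_tendsto_atTop (hL : Tendsto L l atTop) (f : α → ℝ) {k : ℕ} (hk : k ≠ 0) :
    (fun i => f i * L i) =O[l] fun i => f i * L i ^ k := by
  refine (isBigO_refl f l).mul (IsBigO.of_bound 1 ?_)
  filter_upwards [hL.eventually_ge_atTop 1] with i hi
  rw [one_mul, norm_pow]
  exact le_self_pow₀ (hi.trans (Real.le_norm_self _)) hk

end Growth

end SBM

theorem theorem7p2_general
    (N M : ℕ → ℕ) (B : ∀ n, Fin (N n) → Fin (M n)) (p q : ℕ → unitInterval)
    (hN : Tendsto N atTop atTop)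
    (hB : ∀ n m, M n * (Finset.univ.filter fun v => B n v = m).card = N n)
    (hconn : (fun n => (M n : ℝ) * Real.log (N n)) =o[atTop]
      fun n => (N n : ℝ) * (p n : ℝ) + (N n : ℝ) * ((M n : ℝ) - 1) * (q n : ℝ))
    (hq : (fun n => Real.sqrt ((p n : ℝ) * Real.log (N n) / ((N n : ℝ) * (M n : ℝ)))) =O[atTop]
      fun n => (q n : ℝ))
    (ε : ℝ) (hε : 0 < ε) :
    Tendsto (fun n => SBM.sbmMeasure (B n) (p n) (q n)
      {ω | (SBM.graph ω).Connected ∧ ∀ w : Fin (N n), SBM.avgHit ω w ≠ ∞ ∧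
        |(SBM.avgHit ω w).toReal / (N n : ℝ) - 1| ≤ ε}) atTop (𝓝 1) := by
  have hlog : Tendsto (fun n => Real.log (N n)) atTop atTop :=
    Real.tendsto_log_atTop.comp (tendsto_natCast_atTop_atTop.comp hN)
  have hN0 : ∀ᶠ n in atTop, N n ≠ 0 := hN.eventually_ne_atTop 0
  have hM0 : ∀ᶠ n in atTop, M n ≠ 0 :=
    hN0.mono fun n hn => (Fin.pos (B n ⟨0, Nat.pos_of_ne_zero hn⟩)).ne'
  have hlogμ := SBM.isLittleO_meanDegree hM0 hconn
  obtain ⟨hlogm, hgap⟩ := SBM.isLittleO_of_mul_isBigO_sq hlog hlogμ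
    (SBM.isBigO_meanDegree_mul hN0 hM0 (fun n => (p n).2.1) (fun n => (q n).2.1) hlog hlogμ hq)
  exact SBM.tendsto_measure_goodEvent hN
    (fun n v => SBM.degree_meanAdj_edgeProb (hB n) (p n) (q n) v)
    (fun n => SBM.expands_meanAdj_edgeProb (hB n) (p n) (q n))
    (fun n => SBM.expansionRate_nonneg (p n).2.1 (q n).2.1) hlogμ hlogm hgap hε

theorem theorem7p2
    (N M : ℕ → ℕ) (B : ∀ n, Fin (N n) → Fin (M n)) (p q : ℕ → unitInterval)
    (hN : Tendsto N atTop atTop)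
    (hMN : (fun n => (M n : ℝ)) =o[atTop] fun n => (N n : ℝ))
    (hB : ∀ n m, M n * (Finset.univ.filter fun v => B n v = m).card = N n)
    (hconn : (fun n => (M n : ℝ) * Real.log (N n) ^ 4) =o[atTop]
      fun n => (N n : ℝ) * (p n : ℝ) + (N n : ℝ) * ((M n : ℝ) - 1) * (q n : ℝ))
    (hq : (fun n => Real.sqrt ((p n : ℝ) * Real.log (N n) / ((N n : ℝ) * (M n : ℝ)))) =o[atTop]
      fun n => (q n : ℝ))
    (κ : ℝ≥0∞)
    (hκ : Tendsto (fun n => ENNReal.ofReal (((M n : ℝ) - 1) * (q n : ℝ)) /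
      ENNReal.ofReal (p n : ℝ)) atTop (𝓝 κ))
    (ε : ℝ) (hε : 0 < ε) :
    Tendsto (fun n => SBM.sbmMeasure (B n) (p n) (q n)
      {ω | (SBM.graph ω).Connected ∧ ∀ w : Fin (N n), SBM.avgHit ω w ≠ ∞ ∧
        |(SBM.avgHit ω w).toReal / (N n : ℝ) - 1| ≤ ε}) atTop (𝓝 1) :=
  theorem7p2_general N M B p q hN hB ((SBM.isBigO_mul_pow_of_tendsto_atTop
    (Real.tendsto_log_atTop.comp (tendsto_natCast_atTop_atTop.comp hN)) (fun n => (M n : ℝ))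
    four_ne_zero).trans_isLittleO hconn) hq.isBigO ε hε
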